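/- **Definitions.** There are $n$ spaces $1,\dots,n$ along a one-way street and cars $1,\dots,n$ arriving in this order; car $i$ has a preferred space $a_i\in\{1,\dots,n\}$ and parks in the first unoccupied space $s\ge a_i$, if there is one. The sequence $\pi=(a_1,\dots,a_n)$ is a *parking function* of length $n$ if all cars can park; $\mathrm{PF}(n)$ is the set of these. For $\pi\in\mathrm{PF}(n)$ the *outcome* is the permutation $\mathrm{oc}(\pi)=b_1\cdots b_n$ where $b_i$ is the space occupied by car $i$. Let $\mathrm{unl}(\pi)$ be the number of $i$ with $b_i\neq a_i$ (unluckiness), $\mathrm{dis}(\pi)=\sum_i(b_i-a_i)$ (displacement), and let $\mathrm{des}(\pi)$ and $\mathrm{rlm}(\pi)$ be the numbers of descents and of right-to-left maxima of the inverse permutation $\mathrm{oc}(\pi)^{-1}=c_1\cdots c_n$, i.e. the number of $i\le n-1$ with $c_i>c_{i+1}$, and the number of $i\le n$ with $c_i>c_j$ for all $j>i$. Let $\mathcal T_n$ be the set of labelled trees on the vertex set $\{0,1,\dots,n\}$, rooted at $0$. For $T\in\mathcal T_n$ let $\mathrm{inv}(T)$ be the number of pairs $(i,j)$ of vertices with $i<j$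 and $j$ on the path from $0$ to $i$ (inversions); let $\mathrm{nld}(T)$ be the number of vertices $v\ne 0$ that are not the smallest vertex of the subtree rooted at $v$ (non-leaders); let $\mathrm{lev}(T)$ be the number of vertices without children (leaves; a single root is a leaf); and let $\deg_T(0)$ be the number of children of the root. For $n\ge 0$ define, in $\mathbb Z[x,y,z,w]$, $$P_n(x,y,z,w)=\sum_{\pi\in\mathrm{PF}(n)}x^{\mathrm{unl}(\pi)}y^{\mathrm{dis}(\pi)}z^{\mathrm{des}(\pi)}w^{\mathrm{rlm}(\pi)},\qquad Q_n(x,y,z,w)=\sum_{T\in\mathcal T_n}x^{\mathrm{nld}(T)}y^{\mathrm{inv}(T)}z^{\mathrm{lev}(T)-1}w^{\deg_T(0)}.$$ **Theorem.** (a) For every $n\ge 1$, $$P_n(x,y,z,w)=(1+xy+\cdots+xy^{n-1})\,w\,P_{n-1}(x,y,z,1)+\sum_{i=0}^{n-2}\binom{n-1}{i}(1+xy+\cdots+xy^i)\,zw\,P_i(x,y,z,1)\,P_{n-i-1}(x,y,z,w).$$ (b) For every $n\ge 1$, $$Q_n(x,y,z,w)=(1+xy+\cdots+xy^{n-1})\,w\,Q_{n-1}(x,y,z,1)+\sum_{i=0}^{n-2}\binom{n-1}{i}(1+xy+\cdots+xy^i)\,zw\,Q_i(x,y,z,1)\,Q_{n-i-1}(x,y,z,w).$$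 (c) $P_0=Q_0=1$, and $P_n(x,y,z,w)=Q_n(x,y,z,w)$ for every $n\ge 0$. Here $1+xy+\cdots+xy^i$ denotes $1+\sum_{k=1}^{i}xy^k$, which is $1$ for $i=0$. -/

import Mathlib

/-! ### Parking functions

Spaces and cars are indexed by `Fin n`, so that space `s` and car `i` of the usual numbering
`1, …, n` are `s - 1` and `i - 1` here; no statistic below depends on this shift. -/

/-- The space in which car `i` parks when the cars have preferences `π` and arrive in the order
`0, 1, 2, …`: the first space `s ≥ π i` that is not occupied by an earlier car, or `⊤` if there is
no such space (the car then leaves the street without parking). -/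
def parkingSpot {n : ℕ} (π : Fin n → Fin n) (i : Fin n) : WithTop (Fin n) :=
  (Finset.univ.filter fun s : Fin n =>
    π i ≤ s ∧ ∀ j : {j : Fin n // j < i}, parkingSpot π j.1 ≠ (s : WithTop (Fin n))).min
termination_by i
decreasing_by all_goals exact Subtype.property (p := fun j => j < i) _

/-- `π` is a parking function: every car is able to park. -/
def IsParkingFunction {n : ℕ} (π : Fin n → Fin n) : Prop :=
  ∀ i, parkingSpot π i ≠ ⊤

instance {n : ℕ} (π : Fin n → Fin n) : Decidable (IsParkingFunction π) :=
  inferInstanceAs (Decidable (∀ i, parkingSpot π i ≠ ⊤))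

/-- The set `PF(n)` of parking functions of length `n`. -/
abbrev ParkingFunction (n : ℕ) : Type := {π : Fin n → Fin n // IsParkingFunction π}

theorem parkingSpot_ne_of_lt {n : ℕ} (π : Fin n → Fin n) {i j : Fin n} (hji : j < i)
    (hi : parkingSpot π i ≠ ⊤) : parkingSpot π j ≠ parkingSpot π i := by
  obtain ⟨s, hs⟩ := WithTop.ne_top_iff_exists.1 hi
  have h := hs.symm
  rw [parkingSpot] at h
  have hmem := Finset.mem_of_min h
  rw [Finset.mem_filter] at hmem
  rw [← hs]
  exact hmem.2.2 ⟨j, hji⟩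

namespace ParkingFunction

variable {n : ℕ}

/-- The space occupied by car `i`. -/
def space (π : ParkingFunction n) (i : Fin n) : Fin n :=
  (parkingSpot π.1 i).untop (π.2 i)

theorem space_injective (π : ParkingFunction n) : Function.Injective π.space := by
  intro i j hij
  have h : parkingSpot π.1 i = parkingSpot π.1 j := by
    rw [← WithTop.coe_untop _ (π.2 i), ← WithTop.coe_untop _ (π.2 j)]
    exact congrArg _ hij
  rcases lt_trichotomy i j with hlt | heq | hlt
  · exact absurd h (parkingSpot_ne_of_lt π.1 hlt (π.2 j))
  · exact heq
  · exact absurd h.symm (parkingSpot_ne_of_lt π.1 hlt (π.2 i))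

/-- The parking outcome `oc(π)`: the permutation taking each car to the space it occupies. -/
noncomputable def outcome (π : ParkingFunction n) : Equiv.Perm (Fin n) :=
  Equiv.ofBijective π.space (Finite.injective_iff_bijective.1 π.space_injective)

/-- Unluckiness: the number of cars that do not park at their preferred space. -/
noncomputable def unl (π : ParkingFunction n) : ℕ :=
  (Finset.univ.filter fun i : Fin n => π.outcome i ≠ π.1 i).card

/-- Displacement: the total number of failed attempts. No difference is truncated here, since
every car parks at or after its preferred space. -/
noncomputable def dis (π : ParkingFunction n) : ℕ :=
  ∑ i : Fin n, ((π.outcome i : ℕ) - (π.1 i : ℕ))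

end ParkingFunction

/-- The number of descents of a permutation `b`: positions `i` with `b i > b (i + 1)`. -/
def permDescents {n : ℕ} (b : Equiv.Perm (Fin n)) : ℕ :=
  (Finset.univ.filter fun i : Fin n => ∃ h : (i : ℕ) + 1 < n, b ⟨i + 1, h⟩ < b i).card

/-- The number of right-to-left maxima of a permutation `b`: positions `i` with `b i > b j` for
all `j > i`. -/
def permRightToLeftMaxima {n : ℕ} (b : Equiv.Perm (Fin n)) : ℕ :=
  (Finset.univ.filter fun i : Fin n => ∀ j : Fin n, i < j → b j < b i).card

namespace ParkingFunction

variable {n : ℕ}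

/-- The number of descents of the inverse outcome `oc(π)⁻¹`. -/
noncomputable def des (π : ParkingFunction n) : ℕ := permDescents π.outcome⁻¹

/-- The number of right-to-left maxima of the inverse outcome `oc(π)⁻¹`. -/
noncomputable def rlm (π : ParkingFunction n) : ℕ := permRightToLeftMaxima π.outcome⁻¹

end ParkingFunction

/-! ### Labelled trees rooted at `0` -/

/-- The set of trees on the vertex set `{0, …, n}`, each regarded as rooted at `0`. -/
abbrev LabelledTree (n : ℕ) : Type := {G : SimpleGraph (Fin (n + 1)) // G.IsTree}

noncomputable instance (n : ℕ) : Fintype (LabelledTree n) := Fintype.ofFinite _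

namespace LabelledTree

variable {n : ℕ}

/-- `u` lies on the (unique) path from the root `0` to `v`; equivalently, `v` belongs to the
subtree rooted at `u`. In particular every vertex is in its own subtree. -/
def OnRootPath (T : LabelledTree n) (u v : Fin (n + 1)) : Prop :=
  ∃ p : T.1.Walk 0 v, p.IsPath ∧ u ∈ p.support

/-- `v` is a child of `u`. -/
def IsChild (T : LabelledTree n) (v u : Fin (n + 1)) : Prop :=
  T.1.Adj u v ∧ T.OnRootPath u v

open Classical in
/-- The number of inversions: pairs `(i, j)` with `i < j` and `j` on the path from `0` to `i`. -/
noncomputable def inv (T : LabelledTree n) : ℕ :=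
  (Finset.univ.filter fun q : Fin (n + 1) × Fin (n + 1) =>
    q.1 < q.2 ∧ T.OnRootPath q.2 q.1).card

/-- `v` is smallest among all the vertices of the subtree rooted at `v`. -/
def IsLeader (T : LabelledTree n) (v : Fin (n + 1)) : Prop :=
  ∀ u, T.OnRootPath v u → v ≤ u

open Classical in
/-- The number of non-leaders; the root is not counted. -/
noncomputable def nld (T : LabelledTree n) : ℕ :=
  (Finset.univ.filter fun v : Fin (n + 1) => v ≠ 0 ∧ ¬ T.IsLeader v).card

open Classical in
/-- The number of leaves, that is, of vertices without children (so a single root is a leaf). -/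
noncomputable def lev (T : LabelledTree n) : ℕ :=
  (Finset.univ.filter fun v : Fin (n + 1) => ∀ u, ¬ T.IsChild u v).card

open Classical in
/-- The number of children of the root. -/
noncomputable def rootDegree (T : LabelledTree n) : ℕ :=
  (Finset.univ.filter fun v : Fin (n + 1) => T.IsChild v 0).card

end LabelledTree

/-! ### The generating functions

The variables `x, y, z, w` are `X 0, X 1, X 2, X 3`. -/

/-- `P_n(x, y, z, w)`. -/
noncomputable def parkingPoly (n : ℕ) : MvPolynomial (Fin 4) ℤ :=
  ∑ π : ParkingFunction n,
    MvPolynomial.X 0 ^ π.unl * MvPolynomial.X 1 ^ π.dis *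
      MvPolynomial.X 2 ^ π.des * MvPolynomial.X 3 ^ π.rlm

/-- `Q_n(x, y, z, w)`. The exponent `lev - 1` is not truncated: a finite tree has a leaf. -/
noncomputable def treePoly (n : ℕ) : MvPolynomial (Fin 4) ℤ :=
  ∑ T : LabelledTree n,
    MvPolynomial.X 0 ^ T.nld * MvPolynomial.X 1 ^ T.inv *
      MvPolynomial.X 2 ^ (T.lev - 1) * MvPolynomial.X 3 ^ T.rootDegree

/-- The substitution `w = 1`, taking `F(x, y, z, w)` to `F(x, y, z, 1)`. -/
noncomputable def setLastOne (F : MvPolynomial (Fin 4) ℤ) : MvPolynomial (Fin 4) ℤ :=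
  MvPolynomial.aeval
    ![MvPolynomial.X 0, MvPolynomial.X 1, MvPolynomial.X 2, (1 : MvPolynomial (Fin 4) ℤ)] F

/-- The polynomial `1 + x y + x y ^ 2 + ⋯ + x y ^ i`. -/
noncomputable def displacementFactor (i : ℕ) : MvPolynomial (Fin 4) ℤ :=
  1 + ∑ k ∈ Finset.Icc 1 i, MvPolynomial.X 0 * MvPolynomial.X 1 ^ k

/-- A sequence `F` of polynomials satisfies, for all `n ≥ 1`,
`F_n(x,y,z,w) = (1 + xy + ⋯ + xy^(n-1)) w F_(n-1)(x,y,z,1)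
  + ∑_{i=0}^{n-2} C(n-1,i) (1 + xy + ⋯ + xy^i) z w F_i(x,y,z,1) F_(n-i-1)(x,y,z,w)`. -/
def SatisfiesRecurrence (F : ℕ → MvPolynomial (Fin 4) ℤ) : Prop :=
  ∀ n : ℕ, 1 ≤ n →
    F n = displacementFactor (n - 1) * MvPolynomial.X 3 * setLastOne (F (n - 1)) +
      ∑ i ∈ Finset.range (n - 1),
        ((n - 1).choose i : MvPolynomial (Fin 4) ℤ) * displacementFactor i *
          MvPolynomial.X 2 * MvPolynomial.X 3 * setLastOne (F i) * F (n - i - 1)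

/-! ### The common recurrence and its solution. -/

open MvPolynomial

/-! The recurrence and the value `1` at `0` determine a sequence `recPoly`, and both families are
shown to equal it; all parts of the theorem follow. For the induction each family is extended to
sums indexed by an arbitrary finite set `A`, and `eq_recPoly_of_split` reduces the claim to one
decomposition of the objects on `A` relative to an element `a` and a subset `S` of the rest.

Trees: deleting the root `0` leaves a rooted forest on the other vertices. In a forest on `A`, the
tree containing `a` has a vertex set `D = S ∪ {a}` and a root `r ∈ D`. Removing `r` from it leaves a
forest on `|S|` vertices, whose roots are no longer counted by `w`; the other trees form a forest on
`A \ D`. The only new inversions are those of `r` with the smaller elements of `D`, and their number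
runs through `0, …, |S|` as `r` runs through `D`, which produces `1 + xy + ⋯ + xy^|S|`. This is
`forestSum_eq_recPoly`.

Parking functions: when the outcome is fixed, the preferences of the cars are independent of one
another. If `c` is the inverse outcome, read as a word, the car in space `s` may prefer any `p ≤ s`
such that all letters at positions from `p` to `s - 1` are smaller than `c s`. Summing over
preferences gives each letter the displacement factor of the length of the run of smaller letters
before it (`parkingPoly_eq_listSum`). Now split a word as `l₁ M l₂` at its maximum: the run before
`M` is all of `l₁`, runs in `l₂` stop at `M`, and descents and right-to-left maxima split
accordingly. This is `listSum_eq_recPoly`. -/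

/-- The sequence of polynomials determined by the recurrence and the initial value `1`. -/
noncomputable def recPoly : ℕ → MvPolynomial (Fin 4) ℤ
  | 0 => 1
  | n + 1 => displacementFactor n * X 3 * setLastOne (recPoly n) +
      ∑ i : Fin n, (n.choose i : MvPolynomial (Fin 4) ℤ) * displacementFactor i *
          X 2 * X 3 * setLastOne (recPoly i) * recPoly (n - i)
termination_by n => n
decreasing_by all_goals omega

/-- The contribution `z F_m` of a part of size `m` which is only present for `m ≠ 0`. -/
noncomputable def optionalFactor (m : ℕ) : MvPolynomial (Fin 4) ℤ :=
  if m = 0 then 1 else X 2 * recPoly m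

theorem recPoly_zero : recPoly 0 = 1 := by rw [recPoly]

theorem satisfiesRecurrence_recPoly : SatisfiesRecurrence recPoly := by
  intro n hn
  obtain ⟨n, rfl⟩ := Nat.exists_eq_add_of_le' hn
  rw [recPoly, ← Finset.sum_range (fun i => (n.choose i : MvPolynomial (Fin 4) ℤ) *
    displacementFactor i * X 2 * X 3 * setLastOne (recPoly i) * recPoly (n - i))]
  simp only [Nat.add_sub_cancel]
  congr 1
  refine Finset.sum_congr rfl fun i hi => ?_
  rw [Nat.sub_right_comm, Nat.add_sub_cancel]

/-- The isolated first term of the recurrence is the term `i = n` of the sum, where the second part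
is empty and its factor `z` is absent; `optionalFactor` makes the two cases uniform. -/
theorem recPoly_succ_eq_sum (n : ℕ) :
    recPoly (n + 1) = ∑ i ∈ Finset.range (n + 1), n.choose i •
      (displacementFactor i * X 3 * setLastOne (recPoly i) * optionalFactor (n - i)) := by
  rw [recPoly, Finset.sum_range_succ, add_comm, ← Finset.sum_range (fun i =>
    (n.choose i : MvPolynomial (Fin 4) ℤ) *
    displacementFactor i * X 2 * X 3 * setLastOne (recPoly i) * recPoly (n - i))]
  congr 1
  · refine Finset.sum_congr rfl fun i hi => ?_
    rw [Finset.mem_range] at hi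
    rw [optionalFactor, if_neg (by omega), nsmul_eq_mul]
    ring
  · simp [optionalFactor]

/-- A function of finite sets that satisfies the recurrence in the form obtained by splitting off
one marked element depends on the cardinality only and is given by `recPoly`. -/
theorem eq_recPoly_of_split {U : Type*} [DecidableEq U]
    (F : Finset U → MvPolynomial (Fin 4) ℤ) (C : Finset U → Prop)
    (hC : ∀ A B, B ⊆ A → C A → C B) (h0 : F ∅ = 1)
    (hF : ∀ A, C A → A.Nonempty → (∀ B, B ⊂ A → F B = recPoly B.card) →
      ∃ a ∈ A, F A = ∑ S ∈ (A.erase a).powerset,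
        displacementFactor S.card * X 3 * setLastOne (recPoly S.card) *
          optionalFactor ((A.erase a) \ S).card) (A : Finset U) (hA : C A) :
    F A = recPoly A.card := by
  induction A using Finset.strongInduction with
  | H A ih =>
    rcases A.eq_empty_or_nonempty with rfl | hne
    · rw [h0, Finset.card_empty, recPoly_zero]
    · obtain ⟨a, ha, h⟩ := hF A hA hne fun B hB => ih B hB (hC A B hB.1 hA)
      -- The summand depends on `S` only through its cardinality, so grouping the subsets by size
      -- produces the binomial coefficients.
      rw [h, ← Finset.card_erase_add_one ha, recPoly_succ_eq_sum,
        ← Finset.sum_powerset_apply_card (fun i => displacementFactor i * X 3 *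
          setLastOne (recPoly i) * optionalFactor ((A.erase a).card - i))]
      refine Finset.sum_congr rfl fun S hS => ?_
      rw [Finset.card_sdiff_of_subset (Finset.mem_powerset.1 hS)]

/-! ### The substitution `w = 1` and the weight of a single vertex or car. -/

theorem setLastOne_sum {ι : Type*} (s : Finset ι) (f : ι → MvPolynomial (Fin 4) ℤ) :
    setLastOne (∑ i ∈ s, f i) = ∑ i ∈ s, setLastOne (f i) := map_sum _ _ _

theorem setLastOne_prod {ι : Type*} (s : Finset ι) (f : ι → MvPolynomial (Fin 4) ℤ) :
    setLastOne (∏ i ∈ s, f i) = ∏ i ∈ s, setLastOne (f i) := map_prod _ _ _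

theorem setLastOne_mul (p q : MvPolynomial (Fin 4) ℤ) :
    setLastOne (p * q) = setLastOne p * setLastOne q := map_mul _ _ _

theorem setLastOne_pow (p : MvPolynomial (Fin 4) ℤ) (k : ℕ) :
    setLastOne (p ^ k) = setLastOne p ^ k := map_pow _ _ _

theorem setLastOne_one : setLastOne 1 = 1 := map_one _

theorem setLastOne_X_zero : setLastOne (X 0) = X 0 := by simp [setLastOne]

theorem setLastOne_X_one : setLastOne (X 1) = X 1 := by simp [setLastOne]

theorem setLastOne_X_two : setLastOne (X 2) = X 2 := by simp [setLastOne]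

theorem setLastOne_X_three : setLastOne (X 3) = 1 := by simp [setLastOne]

/-- The weight `x ^ [k ≠ 0] y ^ k`. -/
noncomputable def rankWeight (k : ℕ) : MvPolynomial (Fin 4) ℤ :=
  X 0 ^ (if k = 0 then 0 else 1) * X 1 ^ k

theorem setLastOne_rankWeight (k : ℕ) : setLastOne (rankWeight k) = rankWeight k := by
  simp only [rankWeight, setLastOne_mul, setLastOne_pow, setLastOne_X_zero, setLastOne_X_one]

/-- A car displaced by `k`, like a vertex with `k` smaller descendants, has weight `rankWeight k`;
the displacement factor collects the possible values of `k`. -/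
theorem displacementFactor_eq_sum (i : ℕ) :
    displacementFactor i = ∑ k ∈ Finset.range (i + 1), rankWeight k := by
  rw [Finset.sum_range_succ', displacementFactor, add_comm, ← Finset.sum_image (s := Finset.range i)
    (g := fun k => k + 1) (f := rankWeight) (by simp)]
  congr 1
  · have : Finset.Icc 1 i = (Finset.range i).image fun k => k + 1 := by
      ext k
      simp only [Finset.mem_Icc, Finset.mem_image, Finset.mem_range]
      exact ⟨fun h => ⟨k - 1, by omega⟩, by rintro ⟨a, h, rfl⟩; omega⟩
    rw [this]
    refine Finset.sum_congr rfl fun k hk => ?_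
    obtain ⟨a, -, rfl⟩ := Finset.mem_image.1 hk
    simp [rankWeight]
  · simp [rankWeight]

theorem setLastOne_displacementFactor (i : ℕ) :
    setLastOne (displacementFactor i) = displacementFactor i := by
  simp only [displacementFactor_eq_sum, setLastOne_sum, setLastOne_rankWeight]

/-! ### Rooted forests as parent functions. -/

/-- `u` is obtained from `v` by iterating the parent function `f`. -/
def IsAncestor {U : Type*} (f : U → U) (u v : U) : Prop := ∃ k, f^[k] v = u

theorem isAncestor_iff {U : Type*} {f : U → U} {u v : U} :
    IsAncestor f u v ↔ u = v ∨ IsAncestor f u (f v) := by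
  constructor
  · rintro ⟨_ | k, rfl⟩
    · exact Or.inl rfl
    · exact Or.inr ⟨k, rfl⟩
  · rintro (rfl | ⟨k, rfl⟩)
    · exact ⟨0, rfl⟩
    · exact ⟨k + 1, rfl⟩

theorem IsAncestor.refl {U : Type*} (f : U → U) (u : U) : IsAncestor f u u := ⟨0, rfl⟩

theorem IsAncestor.step {U : Type*} {f : U → U} {u v : U} (h : IsAncestor f u (f v)) :
    IsAncestor f u v := isAncestor_iff.2 (Or.inr h)

theorem IsAncestor.eq_of_fixed {U : Type*} {f : U → U} {u v : U} (hv : f v = v)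
    (h : IsAncestor f u v) : u = v := by
  obtain ⟨k, rfl⟩ := h
  exact Function.iterate_fixed hv k

/-- `f` is the parent function of a forest with vertex set `A`; the parent of a root of the
forest is `0`, and so is the value at a non-vertex. -/
structure IsForest {n : ℕ} (A : Finset (Fin (n + 1))) (f : Fin (n + 1) → Fin (n + 1)) : Prop where
  eq_zero_of_notMem : ∀ v, v ∉ A → f v = 0
  eq_zero_or_mem : ∀ v ∈ A, f v = 0 ∨ f v ∈ A
  isAncestor_zero : ∀ v, IsAncestor f 0 v

/-- The number of descendants of `u` that are smaller than `u`. -/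
noncomputable def descRank {n : ℕ} (f : Fin (n + 1) → Fin (n + 1)) (u : Fin (n + 1)) : ℕ :=
  open Classical in (Finset.univ.filter fun x => x < u ∧ IsAncestor f u x).card

/-- The number of childless vertices of a forest. -/
noncomputable def leafCount {n : ℕ} (A : Finset (Fin (n + 1))) (f : Fin (n + 1) → Fin (n + 1)) :
    ℕ :=
  (A.filter fun u => ∀ x, f x ≠ u).card

/-- The number of roots of a forest. -/
noncomputable def rootCount {n : ℕ} (A : Finset (Fin (n + 1))) (f : Fin (n + 1) → Fin (n + 1)) :
    ℕ :=
  (A.filter fun u => f u = 0).card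

/-- The part of the weight of a forest that does not involve the roots. -/
noncomputable def forestCoreWeight {n : ℕ} (A : Finset (Fin (n + 1)))
    (f : Fin (n + 1) → Fin (n + 1)) : MvPolynomial (Fin 4) ℤ :=
  (∏ u ∈ A, rankWeight (descRank f u)) * X 2 ^ (leafCount A f - 1)

/-- The weight of a forest. -/
noncomputable def forestWeight {n : ℕ} (A : Finset (Fin (n + 1)))
    (f : Fin (n + 1) → Fin (n + 1)) : MvPolynomial (Fin 4) ℤ :=
  forestCoreWeight A f * X 3 ^ rootCount A f

theorem setLastOne_forestWeight {n : ℕ} (A : Finset (Fin (n + 1)))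
    (f : Fin (n + 1) → Fin (n + 1)) : setLastOne (forestWeight A f) = forestCoreWeight A f := by
  simp only [forestWeight, forestCoreWeight, setLastOne_mul, setLastOne_prod,
    setLastOne_rankWeight, setLastOne_pow, setLastOne_X_two, setLastOne_X_three, one_pow, mul_one]

namespace IsForest

variable {n : ℕ} {A : Finset (Fin (n + 1))} {f : Fin (n + 1) → Fin (n + 1)}

theorem map_zero (hf : IsForest A f) (h0 : 0 ∉ A) : f 0 = 0 := hf.eq_zero_of_notMem 0 h0

/-- Every vertex reaches `0` after finitely many steps, so one may induct along the path to the
root. This is how acyclicity enters all later arguments. -/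
theorem induct (hf : IsForest A f) {P : Fin (n + 1) → Prop} (zero : P 0)
    (step : ∀ v, v ≠ 0 → P (f v) → P v) (v : Fin (n + 1)) : P v := by
  obtain ⟨k, hk⟩ := hf.isAncestor_zero v
  induction k generalizing v with
  | zero => exact (show v = 0 from hk) ▸ zero
  | succ k ih =>
    by_cases hv : v = 0
    · exact hv ▸ zero
    · exact step v hv (ih (f v) hk)

theorem not_isAncestor_of_notMem (hf : IsForest A f) (h0 : 0 ∉ A) {u v : Fin (n + 1)}
    (hu : u ≠ 0) (huv : u ≠ v) (hv : v ∉ A) : ¬ IsAncestor f u v := by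
  intro h
  rw [isAncestor_iff, hf.eq_zero_of_notMem v hv] at h
  exact h.elim huv fun h => hu (h.eq_of_fixed (hf.map_zero h0))

theorem mem_of_ne_zero (hf : IsForest A f) {v : Fin (n + 1)} (hv : f v ≠ 0) : v ∈ A := by
  by_contra h
  exact hv (hf.eq_zero_of_notMem v h)

theorem map_ne_self (hf : IsForest A f) {v : Fin (n + 1)} (hv : v ≠ 0) : f v ≠ v :=
  fun h => hv ((hf.isAncestor_zero v).eq_of_fixed h).symm

theorem exists_top (hf : IsForest A f) {v : Fin (n + 1)} (hv : v ≠ 0) :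
    ∃ r, r ≠ 0 ∧ f r = 0 ∧ IsAncestor f r v := by
  revert hv
  refine hf.induct (P := fun v => v ≠ 0 → ∃ r, r ≠ 0 ∧ f r = 0 ∧ IsAncestor f r v)
    (fun h => absurd rfl h) (fun v hv ih _ => ?_) v
  by_cases h : f v = 0
  · exact ⟨v, hv, h, IsAncestor.refl f v⟩
  · obtain ⟨r, h1, h2, h3⟩ := ih h
    exact ⟨r, h1, h2, h3.step⟩

/-- Whichever of `r` and `s` is met first on the way up from `v` is sent to the fixed point `0`, so
the other is never met. With `exists_top` this defines the tree containing `v`. -/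
theorem top_unique (hf : IsForest A f) (h0 : 0 ∉ A) {v r s : Fin (n + 1)} (hr0 : r ≠ 0)
    (hs0 : s ≠ 0) (hr : f r = 0) (hs : f s = 0) (hrv : IsAncestor f r v)
    (hsv : IsAncestor f s v) : r = s := by
  have hz := hf.map_zero h0
  revert hrv hsv
  refine hf.induct (P := fun v => IsAncestor f r v → IsAncestor f s v → r = s)
    (fun h => absurd (h.eq_of_fixed hz) hr0) (fun v hv ih h1 h2 => ?_) v
  rcases isAncestor_iff.1 h1 with rfl | h1'
  · rcases isAncestor_iff.1 h2 with rfl | h2'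
    · rfl
    · rw [hr] at h2'
      exact absurd (h2'.eq_of_fixed hz) hs0
  · rcases isAncestor_iff.1 h2 with rfl | h2'
    · rw [hs] at h1'
      exact absurd (h1'.eq_of_fixed hz) hr0
    · exact ih h1' h2'

theorem mem_of_isAncestor (hf : IsForest A f) (h0 : 0 ∉ A) {r v : Fin (n + 1)} (hr0 : r ≠ 0)
    (hv : v ∈ A) (h : IsAncestor f r v) : r ∈ A := by
  revert hv h
  refine hf.induct (P := fun v => v ∈ A → IsAncestor f r v → r ∈ A)
    (fun h => absurd h h0) (fun v _ ih hv h => ?_) v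
  rcases isAncestor_iff.1 h with rfl | h'
  · exact hv
  · rcases hf.eq_zero_or_mem v hv with h1 | h1
    · rw [h1] at h'
      exact absurd (h'.eq_of_fixed (hf.map_zero h0)) hr0
    · exact ih h1 h'

theorem mem_of_isAncestor_of_mem (hf : IsForest A f) (h0 : 0 ∉ A) {r v : Fin (n + 1)} (hr : r ∈ A)
    (h : IsAncestor f r v) : v ∈ A := by
  by_contra hv
  exact hf.not_isAncestor_of_notMem h0 (ne_of_mem_of_not_mem hr h0) (ne_of_mem_of_not_mem hr hv) hv h

/-- If every vertex had a child, then `A ⊆ f(A)`, hence `A = f(A)` by counting; but `f` sends a root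
to `0 ∉ A`. So `leafCount - 1` is truncated for the empty forest only. -/
theorem leafCount_pos (hf : IsForest A f) (h0 : 0 ∉ A) (hA : A.Nonempty) :
    0 < leafCount A f := by
  rw [leafCount, Finset.card_pos]
  by_contra hne
  rw [Finset.not_nonempty_iff_eq_empty, Finset.filter_eq_empty_iff] at hne
  have hsub : A ⊆ A.image f := by
    intro u hu
    have := hne hu
    push Not at this
    obtain ⟨x, hx⟩ := this
    refine Finset.mem_image.2 ⟨x, hf.mem_of_ne_zero ?_, hx⟩
    rw [hx]
    exact fun h => h0 (h ▸ hu)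
  have heq : A = A.image f := Finset.eq_of_subset_of_card_le hsub Finset.card_image_le
  obtain ⟨v, hv⟩ := hA
  obtain ⟨r, hr0, hr, hrv⟩ := hf.exists_top (v := v) fun h => h0 (h ▸ hv)
  have hrA := hf.mem_of_isAncestor h0 hr0 hv hrv
  exact h0 (heq ▸ hr ▸ Finset.mem_image_of_mem f hrA)

end IsForest

/-! ### Splitting off a tree from a forest -/

section Glue

variable {n : ℕ}

/-- The parent function consisting of a tree with root `r` on the vertex set `D`, from which
removal of the root leaves the forest `g`, and a forest `h` on the other vertices. -/
def glueForest (r : Fin (n + 1)) (D : Finset (Fin (n + 1))) (g h : Fin (n + 1) → Fin (n + 1))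
    (u : Fin (n + 1)) : Fin (n + 1) :=
  if u = r then 0 else if u ∈ D then (if g u = 0 then r else g u) else h u

/-- The forest obtained from the tree with root `r` on the vertex set `D` by removing its root. -/
def innerForest (r : Fin (n + 1)) (D : Finset (Fin (n + 1))) (f : Fin (n + 1) → Fin (n + 1))
    (u : Fin (n + 1)) : Fin (n + 1) :=
  if u ∈ D.erase r then (if f u = r then 0 else f u) else 0

/-- The forest obtained by removing the vertices in `D`. -/
def outerForest (D : Finset (Fin (n + 1))) (f : Fin (n + 1) → Fin (n + 1))
    (u : Fin (n + 1)) : Fin (n + 1) :=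
  if u ∈ D then 0 else f u

variable {A D : Finset (Fin (n + 1))} {r : Fin (n + 1)} {f g h : Fin (n + 1) → Fin (n + 1)}

theorem glueForest_root : glueForest r D g h r = 0 := if_pos rfl

theorem glueForest_of_notMem {u : Fin (n + 1)} (hr : r ∈ D) (hu : u ∉ D) :
    glueForest r D g h u = h u := by
  rw [glueForest, if_neg (ne_of_mem_of_not_mem hr hu).symm, if_neg hu]

theorem glueForest_of_eq_zero {u : Fin (n + 1)} (hu : u ∈ D.erase r) (hg : g u = 0) :
    glueForest r D g h u = r := by
  rw [Finset.mem_erase] at hu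
  rw [glueForest, if_neg hu.1, if_pos hu.2, if_pos hg]

theorem glueForest_of_ne_zero {u : Fin (n + 1)} (hu : u ∈ D.erase r) (hg : g u ≠ 0) :
    glueForest r D g h u = g u := by
  rw [Finset.mem_erase] at hu
  rw [glueForest, if_neg hu.1, if_pos hu.2, if_neg hg]

theorem IsForest.glue_apply_mem (hg : IsForest (D.erase r) g) (hr : r ∈ D) {u : Fin (n + 1)}
    (hu : u ∈ D.erase r) : glueForest r D g h u ∈ D := by
  by_cases h1 : g u = 0
  · rwa [glueForest_of_eq_zero hu h1]
  · rw [glueForest_of_ne_zero hu h1]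
    exact Finset.mem_of_mem_erase ((hg.eq_zero_or_mem u hu).resolve_left h1)

theorem IsForest.notMem_of_sdiff (hh : IsForest (A \ D) h) (h0 : 0 ∉ D) (u : Fin (n + 1)) :
    h u ∉ D := by
  by_cases hu : u ∈ A \ D
  · rcases hh.eq_zero_or_mem u hu with h1 | h1
    · rwa [h1]
    · exact (Finset.mem_sdiff.1 h1).2
  · rwa [hh.eq_zero_of_notMem u hu]

theorem IsForest.glue (hg : IsForest (D.erase r) g) (hh : IsForest (A \ D) h) (hr : r ∈ D)
    (hD : D ⊆ A) (h0 : 0 ∉ A) : IsForest A (glueForest r D g h) := by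
  have h0D : 0 ∉ D := fun h => h0 (hD h)
  have hroot : IsAncestor (glueForest r D g h) 0 r :=
    IsAncestor.step (by rw [glueForest_root]; exact IsAncestor.refl _ _)
  have hin : ∀ v, v ∈ D → IsAncestor (glueForest r D g h) 0 v := by
    refine fun v => hg.induct (P := fun v => v ∈ D → IsAncestor (glueForest r D g h) 0 v)
      (fun h => absurd h h0D) (fun v _ ih hv => ?_) v
    by_cases hvr : v = r
    · rwa [hvr]
    · have hv' := Finset.mem_erase.2 ⟨hvr, hv⟩
      refine IsAncestor.step ?_
      by_cases h1 : g v = 0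
      · rwa [glueForest_of_eq_zero hv' h1]
      · have := hg.glue_apply_mem (h := h) hr hv'
        rw [glueForest_of_ne_zero hv' h1] at this ⊢
        exact ih this
  refine ⟨fun v hv => ?_, fun v hv => ?_, fun v => ?_⟩
  · rw [glueForest_of_notMem hr fun h => hv (hD h)]
    exact hh.eq_zero_of_notMem v fun h => hv (Finset.mem_sdiff.1 h).1
  · by_cases hvD : v ∈ D
    · by_cases hvr : v = r
      · exact Or.inl (hvr ▸ glueForest_root)
      · exact Or.inr (hD (hg.glue_apply_mem hr (Finset.mem_erase.2 ⟨hvr, hvD⟩)))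
    · rw [glueForest_of_notMem hr hvD]
      exact (hh.eq_zero_or_mem v (Finset.mem_sdiff.2 ⟨hv, hvD⟩)).imp id
        fun h => (Finset.mem_sdiff.1 h).1
  · refine hh.induct (IsAncestor.refl _ _) (fun v _ ih => ?_) v
    by_cases hvD : v ∈ D
    · exact hin v hvD
    · refine IsAncestor.step ?_
      rwa [glueForest_of_notMem hr hvD]

/-- A path up from `D` stays in `D` until it reaches `r`, and a path starting outside never enters
`D`. Hence `D` can be recovered from the glued forest. -/
theorem isAncestor_glueForest_root (hg : IsForest (D.erase r) g) (hh : IsForest (A \ D) h)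
    (hr : r ∈ D) (hD : D ⊆ A) (h0 : 0 ∉ A) (v : Fin (n + 1)) :
    IsAncestor (glueForest r D g h) r v ↔ v ∈ D := by
  have hF := hg.glue hh hr hD h0
  have h0D : 0 ∉ D := fun h => h0 (hD h)
  refine hF.induct (P := fun v => IsAncestor (glueForest r D g h) r v ↔ v ∈ D) ?_ ?_ v
  · refine iff_of_false (fun h => h0D ?_) h0D
    rwa [← h.eq_of_fixed (hF.map_zero h0)]
  · intro v _ ih
    rw [isAncestor_iff, ih]
    by_cases hvD : v ∈ D
    · refine iff_of_true ?_ hvD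
      by_cases hvr : v = r
      · exact Or.inl hvr.symm
      · exact Or.inr (hg.glue_apply_mem hr (Finset.mem_erase.2 ⟨hvr, hvD⟩))
    · refine iff_of_false ?_ hvD
      rw [glueForest_of_notMem hr hvD]
      rintro (rfl | h1)
      · exact hvD hr
      · exact hh.notMem_of_sdiff h0D v h1

/-- On `D.erase r` gluing only redirects the roots of `g` to `r`, whose parent is `0`; no ancestor
in `D.erase r` is gained or lost. -/
theorem isAncestor_glueForest_inner (hg : IsForest (D.erase r) g) (hh : IsForest (A \ D) h)
    (hr : r ∈ D) (hD : D ⊆ A) (h0 : 0 ∉ A) {u : Fin (n + 1)} (hu : u ∈ D.erase r)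
    (v : Fin (n + 1)) : IsAncestor (glueForest r D g h) u v ↔ IsAncestor g u v := by
  have hF := hg.glue hh hr hD h0
  have h0D : 0 ∉ D := fun h => h0 (hD h)
  have h0E : 0 ∉ D.erase r := fun h => h0D (Finset.mem_of_mem_erase h)
  have hu0 : u ≠ 0 := fun h => h0E (h ▸ hu)
  have hnot : ∀ w, w ∉ D.erase r → ¬ IsAncestor g u w := fun w hw =>
    hg.not_isAncestor_of_notMem h0E hu0 (fun h => hw (h ▸ hu)) hw
  refine hF.induct (P := fun v => IsAncestor (glueForest r D g h) u v ↔ IsAncestor g u v) ?_ ?_ v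
  · exact iff_of_false (fun h => hu0 (h.eq_of_fixed (hF.map_zero h0))) (hnot 0 h0E)
  · intro v _ ih
    rw [isAncestor_iff, ih]
    by_cases hv : v ∈ D.erase r
    · rw [isAncestor_iff (v := v)]
      by_cases h1 : g v = 0
      · rw [glueForest_of_eq_zero hv h1, h1, iff_false_intro (hnot 0 h0E),
          iff_false_intro (hnot r (Finset.notMem_erase r D))]
      · rw [glueForest_of_ne_zero hv h1]
    · refine iff_of_false ?_ (hnot v hv)
      rintro (h1 | h1)
      · exact hv (h1 ▸ hu)
      · refine hnot _ ?_ h1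
        by_cases hvr : v = r
        · rwa [hvr, glueForest_root]
        · have hvD : v ∉ D := fun h => hv (Finset.mem_erase.2 ⟨hvr, h⟩)
          rw [glueForest_of_notMem hr hvD]
          exact fun h => hh.notMem_of_sdiff h0D v (Finset.mem_of_mem_erase h)

/-- `h` takes no value in `D`, so outside `D` the paths are those of `h`, while paths from `D` leave
through `r` straight to `0`. -/
theorem isAncestor_glueForest_outer (hg : IsForest (D.erase r) g) (hh : IsForest (A \ D) h)
    (hr : r ∈ D) (hD : D ⊆ A) (h0 : 0 ∉ A) {u : Fin (n + 1)} (hu : u ∈ A \ D)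
    (v : Fin (n + 1)) : IsAncestor (glueForest r D g h) u v ↔ IsAncestor h u v := by
  have hF := hg.glue hh hr hD h0
  have h0E : 0 ∉ A \ D := fun h => h0 (Finset.mem_sdiff.1 h).1
  have hu0 : u ≠ 0 := fun h => h0E (h ▸ hu)
  have hnot : ∀ w, w ∉ A \ D → ¬ IsAncestor h u w := fun w hw =>
    hh.not_isAncestor_of_notMem h0E hu0 (fun h => hw (h ▸ hu)) hw
  have hnotD : ∀ w, w ∈ D → w ∉ A \ D := fun w hw h => (Finset.mem_sdiff.1 h).2 hw
  refine hF.induct (P := fun v => IsAncestor (glueForest r D g h) u v ↔ IsAncestor h u v) ?_ ?_ v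
  · exact iff_of_false (fun h => hu0 (h.eq_of_fixed (hF.map_zero h0))) (hnot 0 h0E)
  · intro v _ ih
    rw [isAncestor_iff, ih]
    by_cases hv : v ∈ D
    · refine iff_of_false ?_ (hnot v (hnotD v hv))
      rintro (h1 | h1)
      · exact hnotD v hv (h1 ▸ hu)
      · refine hnot _ ?_ h1
        by_cases hvr : v = r
        · rwa [hvr, glueForest_root]
        · exact hnotD _ (hg.glue_apply_mem hr (Finset.mem_erase.2 ⟨hvr, hv⟩))
    · rw [glueForest_of_notMem hr hv, isAncestor_iff (v := v)]

theorem innerForest_glueForest (hg : IsForest (D.erase r) g) :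
    innerForest r D (glueForest r D g h) = g := by
  funext u
  by_cases hu : u ∈ D.erase r
  · rw [innerForest, if_pos hu]
    by_cases h1 : g u = 0
    · rw [glueForest_of_eq_zero hu h1, if_pos rfl, h1]
    · rw [glueForest_of_ne_zero hu h1, if_neg]
      exact Finset.ne_of_mem_erase ((hg.eq_zero_or_mem u hu).resolve_left h1)
  · rw [innerForest, if_neg hu, hg.eq_zero_of_notMem u hu]

theorem outerForest_glueForest (hh : IsForest (A \ D) h) (hr : r ∈ D) :
    outerForest D (glueForest r D g h) = h := by
  funext u
  by_cases hu : u ∈ D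
  · rw [outerForest, if_pos hu, hh.eq_zero_of_notMem u fun h => (Finset.mem_sdiff.1 h).2 hu]
  · rw [outerForest, if_neg hu, glueForest_of_notMem hr hu]

theorem glueForest_inner_outer (hf : IsForest A f) (h0 : 0 ∉ A) (hrA : r ∈ A) (hr : f r = 0)
    (hD : ∀ v, v ∈ D ↔ IsAncestor f r v) :
    glueForest r D (innerForest r D f) (outerForest D f) = f := by
  have hr0 : r ≠ 0 := fun h => h0 (h ▸ hrA)
  have hrD : r ∈ D := (hD r).2 (IsAncestor.refl _ _)
  funext u
  by_cases hu : u ∈ D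
  · by_cases hur : u = r
    · rw [hur, glueForest_root, hr]
    · have hu' := Finset.mem_erase.2 ⟨hur, hu⟩
      by_cases h1 : f u = r
      · rw [glueForest_of_eq_zero hu', h1]
        rw [innerForest, if_pos hu', if_pos h1]
      · have h2 : innerForest r D f u = f u := by rw [innerForest, if_pos hu', if_neg h1]
        rw [glueForest_of_ne_zero hu', h2]
        rw [h2]
        intro h3
        rcases isAncestor_iff.1 ((hD u).1 hu) with h4 | h4
        · exact hur h4.symm
        · rw [h3] at h4
          exact hr0 (h4.eq_of_fixed (hf.map_zero h0))
  · rw [glueForest_of_notMem hrD hu, outerForest, if_neg hu]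

theorem IsForest.inner (hf : IsForest A f) (h0 : 0 ∉ A) (hrA : r ∈ A)
    (hD : ∀ v, v ∈ D ↔ IsAncestor f r v) : IsForest (D.erase r) (innerForest r D f) := by
  have hr0 : r ≠ 0 := fun h => h0 (h ▸ hrA)
  refine ⟨fun v hv => if_neg hv, fun v hv => ?_, fun v => ?_⟩
  · rw [innerForest, if_pos hv]
    split_ifs with h1
    · exact Or.inl rfl
    · refine Or.inr (Finset.mem_erase.2 ⟨h1, (hD _).2 ?_⟩)
      rw [Finset.mem_erase, hD, isAncestor_iff] at hv
      exact hv.2.resolve_left fun h => hv.1 h.symm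
  · refine hf.induct (IsAncestor.refl _ _) (fun v _ ih => IsAncestor.step ?_) v
    rw [innerForest]
    split_ifs
    · exact IsAncestor.refl _ _
    · exact ih
    · exact IsAncestor.refl _ _

theorem IsForest.outer (hf : IsForest A f) (hD : ∀ v, v ∈ D ↔ IsAncestor f r v) :
    IsForest (A \ D) (outerForest D f) := by
  refine ⟨fun v hv => ?_, fun v hv => ?_, fun v => ?_⟩
  · rw [outerForest]
    split_ifs with h1
    · rfl
    · exact hf.eq_zero_of_notMem v fun h => hv (Finset.mem_sdiff.2 ⟨h, h1⟩)
  · rw [Finset.mem_sdiff] at hv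
    rw [outerForest, if_neg hv.2]
    refine (hf.eq_zero_or_mem v hv.1).imp id fun h => Finset.mem_sdiff.2 ⟨h, fun h' => hv.2 ?_⟩
    exact (hD v).2 ((hD _).1 h').step
  · refine hf.induct (IsAncestor.refl _ _) (fun v _ ih => IsAncestor.step ?_) v
    rw [outerForest]
    split_ifs
    · exact IsAncestor.refl _ _
    · exact ih

end Glue

/-! ### The weight of a glued forest. -/

section GlueWeight

variable {n : ℕ} {A D : Finset (Fin (n + 1))} {r : Fin (n + 1)} {g h : Fin (n + 1) → Fin (n + 1)}

theorem descRank_congr {f g : Fin (n + 1) → Fin (n + 1)} {u : Fin (n + 1)}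
    (hfg : ∀ v, IsAncestor f u v ↔ IsAncestor g u v) : descRank f u = descRank g u := by
  rw [descRank, descRank]
  congr 1
  ext v
  simp [hfg]

theorem prod_eq_erase_mul_sdiff {R : Type*} [CommMonoid R] (hr : r ∈ D) (hD : D ⊆ A)
    (φ : Fin (n + 1) → R) :
    ∏ u ∈ A, φ u = φ r * (∏ u ∈ D.erase r, φ u) * ∏ u ∈ A \ D, φ u := by
  rw [Finset.mul_prod_erase D φ hr, mul_comm, Finset.prod_sdiff hD]

theorem card_filter_eq_add {p : Fin (n + 1) → Prop} [DecidablePred p] (hr : r ∈ D) (hD : D ⊆ A) :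
    (A.filter p).card = (if p r then 1 else 0) + ((D.erase r).filter p).card +
      ((A \ D).filter p).card := by
  simp only [Finset.card_filter]
  rw [Finset.add_sum_erase D (fun u => if p u then 1 else 0) hr,
    add_comm (∑ u ∈ D, _), Finset.sum_sdiff hD]

theorem prod_rankWeight_glueForest (hg : IsForest (D.erase r) g) (hh : IsForest (A \ D) h)
    (hr : r ∈ D) (hD : D ⊆ A) (h0 : 0 ∉ A) :
    ∏ u ∈ A, rankWeight (descRank (glueForest r D g h) u) =
      rankWeight (D.filter (· < r)).card * (∏ u ∈ D.erase r, rankWeight (descRank g u)) *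
        ∏ u ∈ A \ D, rankWeight (descRank h u) := by
  rw [prod_eq_erase_mul_sdiff hr hD]
  refine congrArg₂ _ (congrArg₂ _ ?_ ?_) ?_
  · congr 2
    rw [descRank]
    congr 1
    ext v
    simp [isAncestor_glueForest_root hg hh hr hD h0, and_comm]
  · exact Finset.prod_congr rfl fun u hu => congrArg rankWeight <|
      descRank_congr <| isAncestor_glueForest_inner hg hh hr hD h0 hu
  · exact Finset.prod_congr rfl fun u hu => congrArg rankWeight <|
      descRank_congr <| isAncestor_glueForest_outer hg hh hr hD h0 hu

/-- `r` is a leaf exactly when it is alone in its tree, since otherwise the roots of `g` become its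
children; all other vertices keep their children. -/
theorem leafCount_glueForest (hg : IsForest (D.erase r) g) (hh : IsForest (A \ D) h)
    (hr : r ∈ D) (hD : D ⊆ A) (h0 : 0 ∉ A) :
    leafCount A (glueForest r D g h) =
      (if D.erase r = ∅ then 1 else 0) + leafCount (D.erase r) g + leafCount (A \ D) h := by
  have h0D : 0 ∉ D := fun h => h0 (hD h)
  have hr0 : r ≠ 0 := ne_of_mem_of_not_mem hr h0D
  rw [leafCount, card_filter_eq_add hr hD, leafCount, leafCount]
  congr 1
  · congr 1
    · refine if_congr ?_ rfl rfl
      constructor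
      · intro hx
        by_contra hne
        obtain ⟨v, hv⟩ := Finset.nonempty_iff_ne_empty.2 hne
        have h0E : 0 ∉ D.erase r := fun h => h0D (Finset.mem_of_mem_erase h)
        obtain ⟨s, hs0, hs, hsv⟩ := hg.exists_top (ne_of_mem_of_not_mem hv h0E)
        exact hx s (glueForest_of_eq_zero (hg.mem_of_isAncestor h0E hs0 hv hsv) hs)
      · intro hE x hx
        by_cases hxD : x ∈ D
        · by_cases hxr : x = r
          · rw [hxr, glueForest_root] at hx
            exact hr0 hx.symm
          · have := Finset.mem_erase.2 ⟨hxr, hxD⟩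
            rw [hE] at this
            exact Finset.notMem_empty x this
        · rw [glueForest_of_notMem hr hxD] at hx
          exact hh.notMem_of_sdiff h0D x (hx ▸ hr)
    · congr 1
      refine Finset.filter_congr fun u hu => not_iff_not.1 ?_
      push Not
      have hu0 : u ≠ 0 := fun e => h0D (e ▸ Finset.mem_of_mem_erase hu)
      constructor
      · rintro ⟨x, hx⟩
        by_cases hxE : x ∈ D.erase r
        · by_cases h1 : g x = 0
          · rw [glueForest_of_eq_zero hxE h1] at hx
            exact absurd hx.symm (Finset.ne_of_mem_erase hu)
          · rw [glueForest_of_ne_zero hxE h1] at hx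
            exact ⟨x, hx⟩
        · by_cases hxr : x = r
          · rw [hxr, glueForest_root] at hx
            exact absurd hx.symm hu0
          · rw [glueForest_of_notMem hr fun h => hxE (Finset.mem_erase.2 ⟨hxr, h⟩)] at hx
            exact absurd (hx ▸ Finset.mem_of_mem_erase hu) (hh.notMem_of_sdiff h0D x)
      · rintro ⟨x, hx⟩
        have h1 : g x ≠ 0 := hx ▸ hu0
        exact ⟨x, by rw [glueForest_of_ne_zero (hg.mem_of_ne_zero h1) h1, hx]⟩
  · congr 1
    refine Finset.filter_congr fun u hu => not_iff_not.1 ?_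
    push Not
    rw [Finset.mem_sdiff] at hu
    constructor
    · rintro ⟨x, hx⟩
      by_cases hxD : x ∈ D
      · by_cases hxr : x = r
        · rw [hxr, glueForest_root] at hx
          exact absurd (hx ▸ hu.1) h0
        · exact absurd (hx ▸ hg.glue_apply_mem hr (Finset.mem_erase.2 ⟨hxr, hxD⟩)) hu.2
      · rw [glueForest_of_notMem hr hxD] at hx
        exact ⟨x, hx⟩
    · rintro ⟨x, hx⟩
      have h1 : h x ≠ 0 := fun e => h0 (e ▸ hx ▸ hu.1)
      exact ⟨x, by
        rw [glueForest_of_notMem hr (Finset.mem_sdiff.1 (hh.mem_of_ne_zero h1)).2, hx]⟩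

theorem rootCount_glueForest (hg : IsForest (D.erase r) g) (hr : r ∈ D) (hD : D ⊆ A)
    (h0 : 0 ∉ A) :
    rootCount A (glueForest r D g h) = 1 + rootCount (A \ D) h := by
  rw [rootCount, card_filter_eq_add hr hD, if_pos glueForest_root, Finset.filter_false_of_mem,
    Finset.card_empty, add_zero, rootCount]
  · congr 2
    refine Finset.filter_congr fun u hu => ?_
    rw [glueForest_of_notMem hr (Finset.mem_sdiff.1 hu).2]
  · exact fun u hu e => h0 (hD (e ▸ hg.glue_apply_mem (h := h) hr hu))

theorem leafCount_empty (f : Fin (n + 1) → Fin (n + 1)) : leafCount ∅ f = 0 := rfl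

theorem forestWeight_glueForest (hg : IsForest (D.erase r) g) (hh : IsForest (A \ D) h)
    (hr : r ∈ D) (hD : D ⊆ A) (h0 : 0 ∉ A) :
    forestWeight A (glueForest r D g h) =
      rankWeight (D.filter (· < r)).card * X 3 * forestCoreWeight (D.erase r) g *
        (if A \ D = ∅ then 1 else X 2) * forestWeight (A \ D) h := by
  -- The tree on `D` always has `(leafCount (D.erase r) g - 1) + 1` leaves: for `D = {r}` the
  -- truncated difference is `0` and the leaf is `r` itself. The `1` cancels against the one on the
  -- left, so a factor `z` remains exactly when the outer forest is nonempty.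
  have hleaf : leafCount A (glueForest r D g h) - 1 =
      (leafCount (D.erase r) g - 1) + (if A \ D = ∅ then 0 else 1) +
        (leafCount (A \ D) h - 1) := by
    rw [leafCount_glueForest hg hh hr hD h0]
    have h1 : D.erase r = ∅ → leafCount (D.erase r) g = 0 := fun e => by
      rw [e, leafCount_empty]
    have h2 : A \ D = ∅ → leafCount (A \ D) h = 0 := fun e => by rw [e, leafCount_empty]
    have h3 : D.erase r ≠ ∅ → 0 < leafCount (D.erase r) g := fun e =>
      hg.leafCount_pos (fun h => h0 (hD (Finset.mem_of_mem_erase h)))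
        (Finset.nonempty_iff_ne_empty.2 e)
    have h4 : A \ D ≠ ∅ → 0 < leafCount (A \ D) h := fun e =>
      hh.leafCount_pos (fun h => h0 (Finset.mem_sdiff.1 h).1) (Finset.nonempty_iff_ne_empty.2 e)
    split_ifs with e1 e2 e2
    · rw [h1 e1, h2 e2]
    · rw [h1 e1]
      have := h4 e2
      omega
    · have := h3 e1
      have := h2 e2
      omega
    · have := h3 e1
      have := h4 e2
      omega
  have hif : (X 2 : MvPolynomial (Fin 4) ℤ) ^ (if A \ D = ∅ then 0 else 1) =
      if A \ D = ∅ then 1 else X 2 := by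
    split_ifs <;> simp
  rw [forestWeight, forestWeight, forestCoreWeight, forestCoreWeight, forestCoreWeight,
    prod_rankWeight_glueForest hg hh hr hD h0, hleaf, rootCount_glueForest hg hr hD h0,
    pow_add, pow_add, pow_add, hif]
  ring

end GlueWeight

/-! ### The recurrence for forests. -/

section ForestSum

variable {n : ℕ}

open Classical in
/-- The forests with vertex set `A`. -/
noncomputable def forests (A : Finset (Fin (n + 1))) : Finset (Fin (n + 1) → Fin (n + 1)) :=
  Finset.univ.filter (IsForest A)

theorem mem_forests {A : Finset (Fin (n + 1))} {f : Fin (n + 1) → Fin (n + 1)} :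
    f ∈ forests A ↔ IsForest A f := by simp [forests]

/-- The weighted number of forests with vertex set `A`. -/
noncomputable def forestSum (A : Finset (Fin (n + 1))) : MvPolynomial (Fin 4) ℤ :=
  ∑ f ∈ forests A, forestWeight A f

theorem setLastOne_forestSum (A : Finset (Fin (n + 1))) :
    setLastOne (forestSum A) = ∑ f ∈ forests A, forestCoreWeight A f := by
  rw [forestSum, setLastOne_sum]
  exact Finset.sum_congr rfl fun f _ => setLastOne_forestWeight A f

theorem forestSum_empty : forestSum (∅ : Finset (Fin (n + 1))) = 1 := by
  have : forests (∅ : Finset (Fin (n + 1))) = {fun _ => 0} := by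
    ext f
    rw [mem_forests, Finset.mem_singleton]
    constructor
    · exact fun h => funext fun v => h.eq_zero_of_notMem v (Finset.notMem_empty v)
    · rintro rfl
      exact ⟨fun _ _ => rfl, fun _ _ => Or.inl rfl, fun v => ⟨1, rfl⟩⟩
  rw [forestSum, this, Finset.sum_singleton]
  simp [forestWeight, forestCoreWeight, leafCount, rootCount]

open Classical in
-- Gluing is a bijection from pairs of an inner and an outer forest, with inverse given by
-- `innerForest` and `outerForest`, and the weight is multiplicative.
theorem sum_forestWeight_of_root {A D : Finset (Fin (n + 1))} {r : Fin (n + 1)} (hr : r ∈ D)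
    (hD : D ⊆ A) (h0 : 0 ∉ A) :
    ∑ f ∈ (forests A).filter (fun f => f r = 0 ∧ ∀ v, v ∈ D ↔ IsAncestor f r v),
        forestWeight A f =
      rankWeight (D.filter (· < r)).card * X 3 * setLastOne (forestSum (D.erase r)) *
        ((if A \ D = ∅ then 1 else X 2) * forestSum (A \ D)) := by
  rw [setLastOne_forestSum, forestSum, Finset.mul_sum, Finset.mul_sum, Finset.sum_mul_sum,
    ← Finset.sum_product']
  refine Finset.sum_nbij' (fun f => (innerForest r D f, outerForest D f))
    (fun q => glueForest r D q.1 q.2) ?_ ?_ ?_ ?_ ?_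
  · intro f hf
    rw [Finset.mem_filter, mem_forests] at hf
    rw [Finset.mem_product, mem_forests, mem_forests]
    exact ⟨hf.1.inner h0 (hD hr) hf.2.2, hf.1.outer hf.2.2⟩
  · intro q hq
    rw [Finset.mem_product, mem_forests, mem_forests] at hq
    rw [Finset.mem_filter, mem_forests]
    exact ⟨hq.1.glue hq.2 hr hD h0, glueForest_root, fun v =>
      (isAncestor_glueForest_root hq.1 hq.2 hr hD h0 v).symm⟩
  · intro f hf
    rw [Finset.mem_filter, mem_forests] at hf
    exact glueForest_inner_outer hf.1 h0 (hD hr) hf.2.1 hf.2.2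
  · intro q hq
    rw [Finset.mem_product, mem_forests, mem_forests] at hq
    exact Prod.ext (innerForest_glueForest hq.1) (outerForest_glueForest hq.2 hr)
  · intro f hf
    rw [Finset.mem_filter, mem_forests] at hf
    have hi := hf.1.inner h0 (hD hr) hf.2.2
    have ho := hf.1.outer hf.2.2
    conv_lhs => rw [← glueForest_inner_outer hf.1 h0 (hD hr) hf.2.1 hf.2.2]
    rw [forestWeight_glueForest hi ho hr hD h0]
    ring

open Classical in
theorem forestSum_eq_sum {A : Finset (Fin (n + 1))} (h0 : 0 ∉ A) {a : Fin (n + 1)} (ha : a ∈ A) :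
    forestSum A = ∑ S ∈ (A.erase a).powerset, ∑ r ∈ insert a S,
      ∑ f ∈ (forests A).filter (fun f => f r = 0 ∧ ∀ v, v ∈ insert a S ↔ IsAncestor f r v),
        forestWeight A f := by
  have ha0 : a ≠ 0 := ne_of_mem_of_not_mem ha h0
  rw [forestSum, Finset.sum_sigma']
  -- Exactly one pair `(S, r)` fits `f`, namely the one given by the tree containing `a`; exchanging
  -- the sums then sorts the forests by this pair.
  have hdisj : ∀ f ∈ forests A, forestWeight A f =
      ∑ q ∈ (A.erase a).powerset.sigma fun S => insert a S,
        if f q.2 = 0 ∧ ∀ v, v ∈ insert a q.1 ↔ IsAncestor f q.2 v then forestWeight A f else 0 := by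
    intro f hf
    rw [mem_forests] at hf
    obtain ⟨r, hr0, hr, hra⟩ := hf.exists_top ha0
    have hrA := hf.mem_of_isAncestor h0 hr0 ha hra
    have hins : ∀ v, v ∈ insert a ((A.filter (IsAncestor f r)).erase a) ↔ IsAncestor f r v := by
      intro v
      rw [Finset.insert_erase (Finset.mem_filter.2 ⟨ha, hra⟩), Finset.mem_filter,
        and_iff_right_of_imp (hf.mem_of_isAncestor_of_mem h0 hrA)]
    rw [Finset.sum_eq_single ⟨(A.filter (IsAncestor f r)).erase a, r⟩, if_pos ⟨hr, hins⟩]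
    · rintro ⟨S, s⟩ hq hne
      rw [Finset.mem_sigma, Finset.mem_powerset] at hq
      refine if_neg ?_
      rintro ⟨hs, hS⟩
      dsimp only at hs hS hq
      have hsA : s ∈ A := Finset.insert_subset ha
        (hq.1.trans (Finset.erase_subset a A)) hq.2
      have hsr : s = r := hf.top_unique h0 (ne_of_mem_of_not_mem hsA h0) hr0 hs hr
        ((hS a).1 (Finset.mem_insert_self a S)) hra
      subst hsr
      refine hne ?_
      congr 1
      have haS : a ∉ S := fun h => Finset.notMem_erase a A (hq.1 h)
      rw [← Finset.erase_insert haS]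
      congr 1
      ext v
      rw [hS, Finset.mem_filter, and_iff_right_of_imp (hf.mem_of_isAncestor_of_mem h0 hrA)]
    · intro hn
      refine absurd (Finset.mem_sigma.2 ⟨Finset.mem_powerset.2 ?_, ?_⟩) hn
      · exact Finset.erase_subset_erase a (Finset.filter_subset _ A)
      · exact (hins r).2 (IsAncestor.refl f r)
  rw [Finset.sum_congr rfl hdisj, Finset.sum_comm]
  exact Finset.sum_congr rfl fun q _ => (Finset.sum_filter _ _).symm

/-- The elements of `D` have ranks `0, …, |D| - 1`; adjoining a new maximum does not change the
earlier ranks. -/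
theorem sum_rankWeight_card_filter_lt {U : Type*} [LinearOrder U] (D : Finset U) :
    ∑ r ∈ D, rankWeight (D.filter (· < r)).card = ∑ k ∈ Finset.range D.card, rankWeight k := by
  induction D using Finset.induction_on_max with
  | empty => simp
  | insert a s hs ih =>
    have ha : a ∉ s := fun h => lt_irrefl a (hs a h)
    rw [Finset.sum_insert ha, Finset.card_insert_of_notMem ha, Finset.sum_range_succ, ← ih,
      add_comm]
    congr 1
    · refine Finset.sum_congr rfl fun r hr => ?_
      rw [Finset.filter_insert, if_neg (hs r hr).not_gt]
    · rw [Finset.filter_insert, if_neg (lt_irrefl a), Finset.filter_true_of_mem hs]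

theorem forestSum_eq_recPoly {A : Finset (Fin (n + 1))} (h0 : 0 ∉ A) :
    forestSum A = recPoly A.card := by
  refine eq_recPoly_of_split forestSum (fun A => 0 ∉ A) (fun A B h hA hB => hA (h hB))
    forestSum_empty ?_ A h0
  rintro A h0 ⟨a, ha⟩ ih
  refine ⟨a, ha, ?_⟩
  rw [forestSum_eq_sum h0 ha]
  refine Finset.sum_congr rfl fun S hS => ?_
  rw [Finset.mem_powerset] at hS
  have haS : a ∉ S := fun h => Finset.notMem_erase a A (hS h)
  have hD : insert a S ⊆ A := Finset.insert_subset ha (hS.trans (Finset.erase_subset a A))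
  have hsd : A \ insert a S = A.erase a \ S := by
    ext v
    simp only [Finset.mem_sdiff, Finset.mem_insert, Finset.mem_erase]
    tauto
  have hcard : (insert a S).card = S.card + 1 := Finset.card_insert_of_notMem haS
  have hout : (if A \ insert a S = ∅ then 1 else X 2) * forestSum (A \ insert a S) =
      optionalFactor (A.erase a \ S).card := by
    rw [hsd, optionalFactor]
    by_cases he : A.erase a \ S = ∅
    · rw [if_pos he, he, forestSum_empty, Finset.card_empty, if_pos rfl, mul_one]
    · rw [if_neg he, if_neg (by rwa [Finset.card_eq_zero]), ih]
      exact (Finset.sdiff_subset.trans (Finset.erase_subset a A)).ssubset_of_not_subset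
        fun h => Finset.notMem_erase a A (Finset.mem_sdiff.1 (h ha)).1
  -- By induction the inner forests contribute the same amount for every `r ∈ D`, so only the rank
  -- weight of `r` varies. Its sum is the displacement factor of `|D| - 1 = |S|`.
  rw [displacementFactor_eq_sum, ← hcard, ← sum_rankWeight_card_filter_lt, Finset.sum_mul,
    Finset.sum_mul, Finset.sum_mul]
  refine Finset.sum_congr rfl fun r hr => ?_
  rw [sum_forestWeight_of_root hr hD h0, hout, ih, Finset.card_erase_of_mem hr, hcard,
    Nat.add_sub_cancel]
  exact (Finset.erase_ssubset hr).trans_subset hD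

end ForestSum

/-! ### Labelled trees correspond to forests on the nonzero vertices. -/

section TreeOfForest

variable {n : ℕ} {A : Finset (Fin (n + 1))} {f : Fin (n + 1) → Fin (n + 1)}

/-- The graph whose edges join every vertex to its image under `f`. -/
def parentGraph (f : Fin (n + 1) → Fin (n + 1)) : SimpleGraph (Fin (n + 1)) :=
  SimpleGraph.fromRel fun u v => f v = u

theorem parentGraph_adj {u v : Fin (n + 1)} :
    (parentGraph f).Adj u v ↔ u ≠ v ∧ (f v = u ∨ f u = v) :=
  SimpleGraph.fromRel_adj _ u v

theorem IsForest.adj_parentGraph (hf : IsForest A f) {v : Fin (n + 1)} (hv : v ≠ 0) :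
    (parentGraph f).Adj (f v) v :=
  parentGraph_adj.2 ⟨hf.map_ne_self hv, Or.inl rfl⟩

theorem IsAncestor.map {u v : Fin (n + 1)} (h : IsAncestor f u v) : IsAncestor f (f u) v := by
  obtain ⟨k, rfl⟩ := h
  exact ⟨k + 1, Function.iterate_succ_apply' f k v⟩

/-- A cycle through `v` would also pass through `f v`, and so eventually through the fixed point
`0`. -/
theorem IsForest.not_isAncestor_map (hf : IsForest A f) (h0 : 0 ∉ A) {v : Fin (n + 1)}
    (hv : v ≠ 0) : ¬ IsAncestor f v (f v) := by
  revert hv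
  refine hf.induct (P := fun v => v ≠ 0 → ¬ IsAncestor f v (f v)) (fun h => absurd rfl h)
    (fun v hv ih _ h => ?_) v
  by_cases h1 : f v = 0
  · rw [h1] at h
    exact hv (h.eq_of_fixed (hf.map_zero h0))
  · rcases isAncestor_iff.1 h with h2 | h2
    · exact hf.map_ne_self hv h2.symm
    · exact ih h1 h2.map

theorem IsForest.connected_parentGraph (hf : IsForest A f) : (parentGraph f).Connected := by
  rw [SimpleGraph.connected_iff_exists_forall_reachable]
  exact ⟨0, hf.induct (SimpleGraph.Reachable.refl 0) fun v hv ih =>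
    ih.trans (hf.adj_parentGraph hv).reachable⟩

/-- Every edge joins some `v ≠ 0` to `f v`, so there are at most `n` edges; a connected graph on `n
+ 1` vertices with so few edges is a tree. -/
theorem IsForest.isTree_parentGraph (hf : IsForest A f) (h0 : 0 ∉ A) : (parentGraph f).IsTree := by
  rw [SimpleGraph.isTree_iff_connected_and_card]
  refine ⟨hf.connected_parentGraph,
    le_antisymm ?_ hf.connected_parentGraph.card_vert_le_card_edgeSet_add_one⟩
  have hsub : (parentGraph f).edgeSet ⊆
      (((Finset.univ.erase 0).image fun v => s(f v, v) : Finset _) : Set (Sym2 (Fin (n + 1)))) := by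
    intro e
    induction e with
    | _ u v =>
      rw [SimpleGraph.mem_edgeSet, parentGraph_adj, Finset.mem_coe, Finset.mem_image]
      have key : ∀ x y, x ≠ y → f y = x → ∃ a ∈ Finset.univ.erase (0 : Fin (n + 1)),
          s(f a, a) = s(x, y) := by
        rintro x y hne rfl
        refine ⟨y, Finset.mem_erase.2 ⟨?_, Finset.mem_univ y⟩, rfl⟩
        rintro rfl
        exact hne (hf.map_zero h0)
      rintro ⟨hne, h | h⟩
      · exact key u v hne h
      · rw [Sym2.eq_swap]
        exact key v u hne.symm h
  have := Set.ncard_le_ncard hsub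
  rw [Set.ncard_coe_finset] at this
  have h2 := this.trans Finset.card_image_le
  rw [Finset.card_erase_of_mem (Finset.mem_univ _), Finset.card_univ, Fintype.card_fin] at h2
  rw [Nat.card_eq_fintype_card (α := Fin (n + 1)), Fintype.card_fin]
  have h3 : Nat.card (parentGraph f).edgeSet = (parentGraph f).edgeSet.ncard := rfl
  omega

theorem IsForest.exists_path (hf : IsForest A f) (h0 : 0 ∉ A) (v : Fin (n + 1)) :
    ∃ p : (parentGraph f).Walk 0 v, p.IsPath ∧ ∀ u, u ∈ p.support ↔ IsAncestor f u v := by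
  refine hf.induct (P := fun v => ∃ p : (parentGraph f).Walk 0 v, p.IsPath ∧
    ∀ u, u ∈ p.support ↔ IsAncestor f u v) ?_ ?_ v
  · refine ⟨SimpleGraph.Walk.nil, SimpleGraph.Walk.IsPath.nil, fun u => ?_⟩
    rw [SimpleGraph.Walk.support_nil, List.mem_singleton]
    exact ⟨fun h => h ▸ IsAncestor.refl f 0, fun h => h.eq_of_fixed (hf.map_zero h0)⟩
  · rintro v hv ⟨p, hp, hs⟩
    refine ⟨p.concat (hf.adj_parentGraph hv), hp.concat ?_ _, fun u => ?_⟩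
    · rw [hs]
      exact hf.not_isAncestor_map h0 hv
    · rw [SimpleGraph.Walk.support_concat, List.mem_append,
        List.mem_singleton, hs, isAncestor_iff (v := v), or_comm]

/-- The tree with parent function `f`. -/
def IsForest.toTree (hf : IsForest A f) (h0 : 0 ∉ A) : LabelledTree n :=
  ⟨parentGraph f, hf.isTree_parentGraph h0⟩

theorem IsForest.onRootPath_toTree (hf : IsForest A f) (h0 : 0 ∉ A) {u v : Fin (n + 1)} :
    (hf.toTree h0).OnRootPath u v ↔ IsAncestor f u v := by
  obtain ⟨p, hp, hs⟩ := hf.exists_path h0 v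
  constructor
  · rintro ⟨q, hq, hu⟩
    rw [← hs, ((hf.isTree_parentGraph h0).existsUnique_path 0 v).unique hp hq]
    exact hu
  · exact fun h => ⟨p, hp, (hs u).2 h⟩

theorem IsForest.isChild_toTree (hf : IsForest A f) (h0 : 0 ∉ A) {u v : Fin (n + 1)} :
    (hf.toTree h0).IsChild v u ↔ v ≠ 0 ∧ f v = u := by
  rw [LabelledTree.IsChild, hf.onRootPath_toTree h0, toTree, parentGraph_adj]
  constructor
  · rintro ⟨⟨hne, h | h⟩, ha⟩
    · refine ⟨?_, h⟩
      rintro rfl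
      exact hne (h.symm.trans (hf.map_zero h0))
    · rw [← h] at ha
      by_cases hu : u = 0
      · exact absurd (hu.trans ((hf.map_zero h0).symm.trans (hu ▸ h))) hne
      · exact absurd ha (hf.not_isAncestor_map h0 hu)
  · rintro ⟨hv, rfl⟩
    exact ⟨⟨hf.map_ne_self hv, Or.inl rfl⟩, (IsAncestor.refl f (f v)).step⟩

end TreeOfForest

section ForestOfTree

variable {n : ℕ}

/-- The parent of `v` is the penultimate vertex of the path from `0` to `v`. Passing to the parent
shortens this path, so `0` is reached. -/
theorem LabelledTree.exists_isForest (T : LabelledTree n) :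
    ∃ (f : Fin (n + 1) → Fin (n + 1)) (hf : IsForest (Finset.univ.erase 0) f),
      hf.toTree (Finset.notMem_erase _ _) = T := by
  have hT := T.2
  choose p hp hu using hT.existsUnique_path 0
  obtain ⟨f, hpen⟩ : ∃ f : Fin (n + 1) → Fin (n + 1), ∀ v, (p v).penultimate = f v :=
    ⟨_, fun _ => rfl⟩
  have hadj : ∀ v, v ≠ 0 → T.1.Adj (f v) v := fun v hv =>
    hpen v ▸ SimpleGraph.Walk.adj_penultimate fun h => hv h.eq.symm
  -- The trivial path has its only vertex as penultimate vertex, which matches the convention for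
  -- parent functions.
  have hzero : f 0 = 0 := by
    rw [← hpen, ← hu 0 SimpleGraph.Walk.nil SimpleGraph.Walk.IsPath.nil,
      SimpleGraph.Walk.penultimate_nil]
  have hanc : ∀ k v, (p v).length = k → IsAncestor f 0 v := by
    intro k
    induction k with
    | zero => exact fun v hk => SimpleGraph.Walk.eq_of_length_eq_zero hk ▸ IsAncestor.refl f 0
    | succ k ih =>
      intro v hk
      refine IsAncestor.step (ih _ ?_)
      have h1 : (p (p v).penultimate).length = k := by
        rw [← hu _ (p v).dropLast (hp v).dropLast, SimpleGraph.Walk.length_dropLast, hk,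
          Nat.add_sub_cancel]
      rwa [hpen v] at h1
  have hf : IsForest (Finset.univ.erase 0) f := by
    refine ⟨fun v hv => ?_, fun v _ => ?_, fun v => hanc _ v rfl⟩
    · rw [Finset.mem_erase, and_iff_left (Finset.mem_univ v), not_not] at hv
      rw [hv, hzero]
    · rw [Finset.mem_erase, and_iff_left (Finset.mem_univ _)]
      exact em _
  refine ⟨f, hf, Subtype.ext ?_⟩
  ext u v
  rw [IsForest.toTree, parentGraph_adj]
  constructor
  · rintro ⟨hne, h | h⟩
    · subst h
      refine hadj v ?_
      rintro rfl
      exact hne hzero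
    · subst h
      refine (hadj u ?_).symm
      rintro rfl
      exact hne hzero.symm
  · intro h
    refine ⟨h.ne, ?_⟩
    rw [← hpen, ← hpen]
    -- Of two adjacent vertices one lies on the root path of the other, and is then its penultimate
    -- vertex.
    by_cases hv : v ∈ (p u).support
    · exact Or.inr (hT.isAcyclic.eq_penultimate_of_adj_end (hp u) h hv).symm
    · exact Or.inl (hT.isAcyclic.eq_penultimate_of_adj_end (hp v) h.symm
        (hT.isAcyclic.mem_support_of_ne_mem_support_of_adj_of_isPath (hp v) (hp u) h.symm hv)).symm

theorem IsForest.toTree_injective {A : Finset (Fin (n + 1))} {f g : Fin (n + 1) → Fin (n + 1)}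
    (h0 : 0 ∉ A) (hf : IsForest A f) (hg : IsForest A g) 
    (h : hf.toTree h0 = hg.toTree h0) : f = g := by
  funext v
  by_cases hv : v = 0
  · rw [hv, hf.map_zero h0, hg.map_zero h0]
  · have := (hf.isChild_toTree h0).2 ⟨hv, rfl⟩
    rw [h, hg.isChild_toTree h0] at this
    exact this.2.symm

end ForestOfTree

/-! ### Tree statistics in terms of parent functions. -/

section TreeWeight

variable {n : ℕ} {f : Fin (n + 1) → Fin (n + 1)}

theorem isLeader_toTree_iff {A : Finset (Fin (n + 1))} (hf : IsForest A f) (h0 : 0 ∉ A)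
    (v : Fin (n + 1)) : (hf.toTree h0).IsLeader v ↔ descRank f v = 0 := by
  classical
  rw [descRank, Finset.card_eq_zero, Finset.filter_eq_empty_iff, LabelledTree.IsLeader]
  simp only [hf.onRootPath_toTree h0]
  exact ⟨fun h u _ hu => (h u hu.2).not_gt hu.1,
    fun h u hu => not_lt.1 fun hlt => h (Finset.mem_univ u) ⟨hlt, hu⟩⟩

theorem nld_toTree (hf : IsForest (Finset.univ.erase 0) f) :
    (hf.toTree (Finset.notMem_erase _ _)).nld = ∑ u ∈ Finset.univ.erase 0, if descRank f u = 0 then 0 else 1 := by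
  have h0 := Finset.notMem_erase (0 : Fin (n + 1)) Finset.univ
  rw [← Finset.sum_congr rfl fun u _ => ite_not (descRank f u = 0) 1 0, ← Finset.card_filter,
    LabelledTree.nld]
  congr 1
  ext v
  simp [isLeader_toTree_iff hf h0]

/-- Inversions are counted by their larger vertex, which is the ancestor; the root `0` is never the
larger one. -/
theorem inv_toTree (hf : IsForest (Finset.univ.erase 0) f) :
    (hf.toTree (Finset.notMem_erase _ _)).inv = ∑ u ∈ Finset.univ.erase 0, descRank f u := by
  classical
  have h0 := Finset.notMem_erase (0 : Fin (n + 1)) Finset.univ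
  have hz : descRank f 0 = 0 := by
    rw [descRank, Finset.card_eq_zero, Finset.filter_eq_empty_iff]
    exact fun x _ h => Fin.not_lt_zero x h.1
  rw [Finset.sum_erase _ hz, LabelledTree.inv, Finset.card_filter, ← Finset.univ_product_univ,
    Finset.sum_product_right]
  refine Finset.sum_congr rfl fun u _ => ?_
  rw [← Finset.card_filter, descRank]
  congr 1
  ext x
  simp [hf.onRootPath_toTree h0]

theorem lev_toTree_sub_one (hf : IsForest (Finset.univ.erase 0) f) :
    (hf.toTree (Finset.notMem_erase _ _)).lev - 1 = leafCount (Finset.univ.erase 0) f - 1 := by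
  classical
  have h0 := Finset.notMem_erase (0 : Fin (n + 1)) Finset.univ
  have hlev : ∀ v : Fin (n + 1), v ≠ 0 → ((∀ u, ¬ (hf.toTree h0).IsChild u v) ↔ ∀ x, f x ≠ v) := by
    intro v hv
    refine forall_congr' fun u => not_congr ?_
    rw [hf.isChild_toTree h0, and_iff_right_of_imp]
    rintro rfl rfl
    exact hv (hf.map_zero h0)
  -- If `0` is the only vertex, it is a leaf of the tree missing from the forest, but both
  -- differences are `0`. Otherwise `0` has a child and the leaves agree.
  rcases (Finset.univ.erase (0 : Fin (n + 1))).eq_empty_or_nonempty with he | ⟨v, hv⟩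
  · have hl : leafCount (Finset.univ.erase 0) f = 0 := by rw [he, leafCount_empty]
    rw [hl, LabelledTree.lev, Nat.zero_sub]
    refine Nat.sub_eq_zero_of_le ((Finset.card_filter_le _ _).trans ?_)
    rw [← Finset.insert_erase (Finset.mem_univ (0 : Fin (n + 1))), he]
    rfl
  · rw [LabelledTree.lev, leafCount]
    congr 2
    ext u
    rw [Finset.mem_filter, Finset.mem_filter, Finset.mem_erase]
    by_cases hu : u = 0
    · refine iff_of_false ?_ fun h => h.1.1 hu
      obtain ⟨r, hr0, hr, -⟩ := hf.exists_top (ne_of_mem_of_not_mem hv h0)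
      exact fun h => h.2 r ((hf.isChild_toTree h0).2 ⟨hr0, hr.trans hu.symm⟩)
    · rw [hlev u hu]
      simp [hu]

theorem rootDegree_toTree (hf : IsForest (Finset.univ.erase 0) f) :
    (hf.toTree (Finset.notMem_erase _ _)).rootDegree = rootCount (Finset.univ.erase 0) f := by
  have h0 := Finset.notMem_erase (0 : Fin (n + 1)) Finset.univ
  rw [LabelledTree.rootDegree, rootCount]
  congr 1
  ext v
  simp [hf.isChild_toTree h0]

theorem prod_rankWeight {ι : Type*} (s : Finset ι) (k : ι → ℕ) :
    ∏ i ∈ s, rankWeight (k i) =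
      X 0 ^ (∑ i ∈ s, if k i = 0 then 0 else 1) * X 1 ^ ∑ i ∈ s, k i := by
  simp only [rankWeight, Finset.prod_mul_distrib, Finset.prod_pow_eq_pow_sum]

theorem treePoly_eq_forestSum (n : ℕ) :
    treePoly n = forestSum (Finset.univ.erase (0 : Fin (n + 1))) := by
  symm
  refine Finset.sum_bij (fun f hf => (mem_forests.1 hf).toTree (Finset.notMem_erase _ _)) (fun _ _ => Finset.mem_univ _)
    (fun f hf g hg h => IsForest.toTree_injective (Finset.notMem_erase _ _) _ _ h)
    (fun T _ => ?_) (fun f hf => ?_)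
  · obtain ⟨f, hf, h⟩ := T.exists_isForest
    exact ⟨f, mem_forests.2 hf, h⟩
  · rw [nld_toTree, inv_toTree, lev_toTree_sub_one, rootDegree_toTree, forestWeight,
      forestCoreWeight, prod_rankWeight]

theorem treePoly_eq_recPoly (n : ℕ) : treePoly n = recPoly n := by
  rw [treePoly_eq_forestSum, forestSum_eq_recPoly (Finset.notMem_erase _ _),
    Finset.card_erase_of_mem (Finset.mem_univ _), Finset.card_univ, Fintype.card_fin,
    Nat.add_sub_cancel]

end TreeWeight

/-! ### Words without repetitions, split at their maximum. -/

section ListStatistics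

variable {U : Type*} [LinearOrder U]

/-- The number of descents of a word. -/
def listDescents : List U → ℕ
  | [] => 0
  | [_] => 0
  | a :: b :: l => (if b < a then 1 else 0) + listDescents (b :: l)

/-- The number of right-to-left maxima of a word. -/
def listRightToLeftMaxima : List U → ℕ
  | [] => 0
  | a :: l => (if ∀ b ∈ l, b < a then 1 else 0) + listRightToLeftMaxima l

/-- The product over the letters `a` of a word `l` of the displacement factors of the numbers of
consecutive smaller letters directly before `a`, where `l` is preceded by the reversal of `acc`. -/
noncomputable def runWeight : List U → List U → MvPolynomial (Fin 4) ℤ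
  | _, [] => 1
  | acc, a :: l =>
    displacementFactor (acc.takeWhile fun b => decide (b < a)).length * runWeight (a :: acc) l

/-- The weight of a word. -/
noncomputable def listWeight (l : List U) : MvPolynomial (Fin 4) ℤ :=
  runWeight [] l * X 2 ^ listDescents l * X 3 ^ listRightToLeftMaxima l

/-- The step into `M` is an ascent and the step out of it, if there is one, a descent. -/
theorem listDescents_append_max {l₁ l₂ : List U} {M : U} (h₁ : ∀ a ∈ l₁, a < M)
    (h₂ : ∀ a ∈ l₂, a < M) :
    listDescents (l₁ ++ M :: l₂) =
      listDescents l₁ + (if l₂ = [] then 0 else 1) + listDescents l₂ := by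
  induction l₁ with
  | nil =>
    cases l₂ with
    | nil => simp [listDescents]
    | cons b l => simp [listDescents, h₂ b List.mem_cons_self]
  | cons a l₁ ih =>
    have ih := ih fun b hb => h₁ b (List.mem_cons_of_mem a hb)
    cases l₁ with
    | nil =>
      have : ¬ M < a := (h₁ a List.mem_cons_self).not_gt
      simp only [List.nil_append] at ih
      simp [listDescents, this, ih]
    | cons b l =>
      simp only [List.cons_append] at ih ⊢
      rw [listDescents, ih, listDescents]
      ring

/-- `M` disqualifies all letters before it and does not affect those after it. -/
theorem listRightToLeftMaxima_append_max {l₁ l₂ : List U} {M : U} (h₁ : ∀ a ∈ l₁, a < M)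
    (h₂ : ∀ a ∈ l₂, a < M) :
    listRightToLeftMaxima (l₁ ++ M :: l₂) = 1 + listRightToLeftMaxima l₂ := by
  induction l₁ with
  | nil => rw [List.nil_append, listRightToLeftMaxima, if_pos h₂]
  | cons a l₁ ih =>
    rw [List.cons_append, listRightToLeftMaxima, ih fun b hb => h₁ b (List.mem_cons_of_mem a hb),
      if_neg, zero_add]
    exact fun h => (h₁ a List.mem_cons_self).not_gt (h M (by simp))

theorem runWeight_append (acc l₁ l₂ : List U) :
    runWeight acc (l₁ ++ l₂) = runWeight acc l₁ * runWeight (l₁.reverse ++ acc) l₂ := by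
  induction l₁ generalizing acc with
  | nil => simp [runWeight]
  | cons a l₁ ih =>
    rw [List.cons_append, runWeight, runWeight, ih, mul_assoc, List.reverse_cons,
      List.append_assoc, List.singleton_append]

theorem takeWhile_append_cons_of_neg {α : Type*} {p : α → Bool} {l l' : List α} {M : α} (hM : ¬ p M) :
    (l ++ M :: l').takeWhile p = l.takeWhile p := by
  induction l with
  | nil => simp [hM]
  | cons a l ih => simp only [List.cons_append, List.takeWhile_cons, ih]

/-- A run of letters smaller than some `a < M` cannot extend past `M`, so what precedes `M` is
irrelevant. -/
theorem runWeight_append_cons_of_lt {acc acc' l : List U} {M : U} (h : ∀ a ∈ l, a < M) :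
    runWeight (acc ++ M :: acc') l = runWeight acc l := by
  induction l generalizing acc with
  | nil => rw [runWeight, runWeight]
  | cons a l ih =>
    have ha := h a List.mem_cons_self
    rw [runWeight, runWeight, takeWhile_append_cons_of_neg (by simpa using ha.le),
      ← List.cons_append, ih fun b hb => h b (List.mem_cons_of_mem a hb)]

theorem runWeight_append_max {l₁ l₂ : List U} {M : U} (h₁ : ∀ a ∈ l₁, a < M)
    (h₂ : ∀ a ∈ l₂, a < M) :
    runWeight [] (l₁ ++ M :: l₂) =
      displacementFactor l₁.length * runWeight [] l₁ * runWeight [] l₂ := by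
  have h : (l₁.reverse.takeWhile fun b => decide (b < M)) = l₁.reverse := by
    rw [List.takeWhile_eq_self_iff]
    simpa using h₁
  rw [runWeight_append, List.append_nil, runWeight, h, List.length_reverse,
    ← List.nil_append (M :: _), runWeight_append_cons_of_lt h₂]
  ring

theorem setLastOne_runWeight (acc l : List U) :
    setLastOne (runWeight acc l) = runWeight acc l := by
  induction l generalizing acc with
  | nil => rw [runWeight, setLastOne_one]
  | cons a l ih => rw [runWeight, setLastOne_mul, setLastOne_displacementFactor, ih]

theorem listWeight_append_max {l₁ l₂ : List U} {M : U} (h₁ : ∀ a ∈ l₁, a < M)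
    (h₂ : ∀ a ∈ l₂, a < M) :
    listWeight (l₁ ++ M :: l₂) = displacementFactor l₁.length * X 3 * setLastOne (listWeight l₁) *
      ((if l₂ = [] then 1 else X 2) * listWeight l₂) := by
  have hif : (X 2 : MvPolynomial (Fin 4) ℤ) ^ (if l₂ = [] then 0 else 1) =
      if l₂ = [] then 1 else X 2 := by
    split_ifs <;> simp
  simp only [listWeight, listDescents_append_max h₁ h₂, listRightToLeftMaxima_append_max h₁ h₂,
    runWeight_append_max h₁ h₂, setLastOne_mul, setLastOne_pow, setLastOne_runWeight,
    setLastOne_X_two, setLastOne_X_three, one_pow, mul_one, pow_add, hif]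
  ring

/-- The arrangements of a finite set as words without repetitions. -/
def arrangements (A : Finset U) : Finset (List U) := (Multiset.lists A.val).toFinset

/-- The sum of the weights of all arrangements of a finite set. -/
noncomputable def listSum (A : Finset U) : MvPolynomial (Fin 4) ℤ :=
  ∑ l ∈ arrangements A, listWeight l

theorem mem_arrangements {A : Finset U} {l : List U} :
    l ∈ arrangements A ↔ l.Nodup ∧ ∀ a, a ∈ l ↔ a ∈ A := by
  rw [arrangements, Multiset.mem_toFinset, Multiset.mem_lists_iff]
  constructor
  · intro h
    have h' : A.val = (l : Multiset U) := h
    refine ⟨Multiset.coe_nodup.1 (h' ▸ A.nodup), fun a => ?_⟩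
    rw [← Multiset.mem_coe, ← h', Finset.mem_val]
  · exact fun h => (Multiset.Nodup.ext A.nodup (Multiset.coe_nodup.2 h.1)).2 fun a =>
      (h.2 a).symm

theorem length_of_mem_arrangements {A : Finset U} {l : List U} (h : l ∈ arrangements A) :
    l.length = A.card := by
  rw [arrangements, Multiset.mem_toFinset, Multiset.mem_lists_iff] at h
  rw [Finset.card_def, h]
  rfl

theorem eq_nil_iff_of_mem_arrangements {A : Finset U} {l : List U} (h : l ∈ arrangements A) :
    l = [] ↔ A = ∅ := by
  rw [← List.length_eq_zero_iff, length_of_mem_arrangements h, Finset.card_eq_zero]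

theorem listSum_empty : listSum (∅ : Finset U) = 1 := by
  have : arrangements (∅ : Finset U) = {[]} := by
    ext l
    rw [Finset.mem_singleton, arrangements, Multiset.mem_toFinset, Multiset.mem_lists_iff]
    exact ⟨fun h => (Multiset.coe_eq_zero l).1 h.symm, fun h => h ▸ rfl⟩
  rw [listSum, this, Finset.sum_singleton]
  simp [listWeight, runWeight, listDescents, listRightToLeftMaxima]

/-- `M` occurs exactly once, so a word is determined by the set `S` of letters before `M` and the
arrangements on the two sides. -/
theorem sum_arrangements_eq_sum_append {R : Type*} [AddCommMonoid R] {A : Finset U} {M : U} (hM : M ∈ A)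
    (φ : List U → R) :
    ∑ l ∈ arrangements A, φ l = ∑ S ∈ (A.erase M).powerset,
      ∑ q ∈ arrangements S ×ˢ arrangements (A.erase M \ S), φ (q.1 ++ M :: q.2) := by
  rw [Finset.sum_sigma']
  symm
  refine Finset.sum_bij (fun q _ => q.2.1 ++ M :: q.2.2) ?_ ?_ ?_ fun _ _ => rfl
  · rintro ⟨S, l₁, l₂⟩ hq
    simp only [Finset.mem_sigma, Finset.mem_powerset, Finset.mem_product, mem_arrangements,
      Finset.mem_sdiff, Finset.mem_erase] at hq
    obtain ⟨hS, ⟨n₁, h₁⟩, n₂, h₂⟩ := hq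
    rw [mem_arrangements]
    have hMS : M ∉ S := fun h => Finset.notMem_erase M A (hS h)
    refine ⟨?_, fun a => ?_⟩
    · rw [List.nodup_append]
      refine ⟨n₁, List.nodup_cons.2 ⟨fun h => ((h₂ M).1 h).1.1 rfl, n₂⟩, ?_⟩
      rintro a ha b hb rfl
      rcases List.mem_cons.1 hb with rfl | hb
      · exact hMS ((h₁ a).1 ha)
      · exact ((h₂ a).1 hb).2 ((h₁ a).1 ha)
    · rw [List.mem_append, List.mem_cons, h₁, h₂]
      constructor
      · rintro (h | rfl | h)
        · exact Finset.mem_of_mem_erase (hS h)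
        · exact hM
        · exact h.1.2
      · intro h
        by_cases h1 : a = M
        · exact Or.inr (Or.inl h1)
        · by_cases h2 : a ∈ S
          · exact Or.inl h2
          · exact Or.inr (Or.inr ⟨⟨h1, h⟩, h2⟩)
  · rintro ⟨S, l₁, l₂⟩ hq ⟨S', l₁', l₂'⟩ hq' h
    simp only [Finset.mem_sigma, Finset.mem_powerset, Finset.mem_product, mem_arrangements,
      Finset.mem_sdiff, Finset.mem_erase] at hq hq'
    have m₁ : M ∉ l₁ := fun h => Finset.notMem_erase M A (hq.1 ((hq.2.1.2 M).1 h))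
    have m₂ : M ∉ l₂ := fun h => ((hq.2.2.2 M).1 h).1.1 rfl
    obtain ⟨rfl, -, rfl⟩ := (List.append_cons_inj_of_notMem m₁ m₂).1 h
    have : S = S' := by
      ext a
      rw [← hq.2.1.2, ← hq'.2.1.2]
    rw [this]
  · intro l hl
    rw [mem_arrangements] at hl
    obtain ⟨l₁, l₂, rfl⟩ := List.append_of_mem ((hl.2 M).2 hM)
    have hn := hl.1
    rw [List.nodup_append, List.nodup_cons] at hn
    obtain ⟨n₁, ⟨hM₂, n₂⟩, hd⟩ := hn
    refine ⟨⟨l₁.toFinset, l₁, l₂⟩, ?_, rfl⟩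
    simp only [Finset.mem_sigma, Finset.mem_powerset, Finset.mem_product, mem_arrangements,
      Finset.mem_sdiff, Finset.mem_erase, List.mem_toFinset]
    refine ⟨fun a ha => ?_, ⟨n₁, fun a => trivial⟩, n₂, fun a => ⟨fun h => ⟨⟨?_, ?_⟩, ?_⟩, ?_⟩⟩
    · rw [List.mem_toFinset] at ha
      rw [Finset.mem_erase, ← hl.2]
      exact ⟨hd a ha M List.mem_cons_self, List.mem_append_left _ ha⟩
    · exact ne_of_mem_of_not_mem h hM₂
    · exact (hl.2 a).1 (List.mem_append_right _ (List.mem_cons_of_mem _ h))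
    · exact fun h' => hd a h' a (List.mem_cons_of_mem _ h) rfl
    · rintro ⟨⟨h1, h2⟩, h3⟩
      rw [← hl.2, List.mem_append, List.mem_cons] at h2
      exact (h2.resolve_left h3).resolve_left h1

/-- The distinguished element is the maximum of `A`, and `S` is the set of letters before it. -/
theorem listSum_eq_recPoly (A : Finset U) : listSum A = recPoly A.card := by
  refine eq_recPoly_of_split listSum (fun _ => True) (fun _ _ _ _ => trivial) listSum_empty
    ?_ A trivial
  rintro A - hne ih
  have hM := A.max'_mem hne
  set M := A.max' hne
  have hlt : ∀ a ∈ A.erase M, a < M := fun a ha =>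
    lt_of_le_of_ne (A.le_max' a (Finset.mem_of_mem_erase ha)) (Finset.ne_of_mem_erase ha)
  refine ⟨M, hM, ?_⟩
  rw [listSum, sum_arrangements_eq_sum_append hM]
  refine Finset.sum_congr rfl fun S hS => ?_
  rw [Finset.mem_powerset] at hS
  have hss : A.erase M ⊂ A := Finset.erase_ssubset hM
  have hout : (if A.erase M \ S = ∅ then 1 else X 2) * listSum (A.erase M \ S) =
      optionalFactor (A.erase M \ S).card := by
    rw [optionalFactor]
    by_cases he : A.erase M \ S = ∅
    · rw [if_pos he, he, listSum_empty, Finset.card_empty, if_pos rfl, mul_one]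
    · rw [if_neg he, if_neg (by rwa [Finset.card_eq_zero]),
        ih _ (Finset.sdiff_subset.trans_ssubset hss)]
  rw [← hout, ← ih S (hS.trans_ssubset hss), listSum, listSum, setLastOne_sum, Finset.mul_sum,
    Finset.mul_sum, Finset.sum_mul_sum, ← Finset.sum_product']
  refine Finset.sum_congr rfl fun q hq => ?_
  rw [Finset.mem_product] at hq
  have h₁ := mem_arrangements.1 hq.1
  have h₂ := mem_arrangements.1 hq.2
  rw [listWeight_append_max (fun a ha => hlt a (hS ((h₁.2 a).1 ha)))
    (fun a ha => hlt a (Finset.mem_sdiff.1 ((h₂.2 a).1 ha)).1), length_of_mem_arrangements hq.1,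
    if_congr (eq_nil_iff_of_mem_arrangements hq.2) rfl rfl]

end ListStatistics

/-! ### Statistics of words written as functions on positions. -/

section WordsOfFunctions

variable {U : Type*} [LinearOrder U]

theorem listDescents_ofFn {n : ℕ} (g : Fin n → U) :
    listDescents (List.ofFn g) =
      (Finset.univ.filter fun i : Fin n => ∃ h : (i : ℕ) + 1 < n, g ⟨i + 1, h⟩ < g i).card := by
  induction n with
  | zero => simp [listDescents]
  | succ n ih =>
    cases n with
    | zero =>
      rw [Finset.filter_false_of_mem fun i _ ⟨h, _⟩ => by omega]
      simp [listDescents]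
    | succ n =>
      rw [List.ofFn_succ, List.ofFn_succ, listDescents, ← List.ofFn_succ (f := fun i => g i.succ),
        ih]
      refine Eq.trans ?_ (Fin.card_filter_univ_succ _).symm
      have h0 : (∃ h : ((0 : Fin (n + 2)) : ℕ) + 1 < n + 1 + 1, g ⟨(0 : Fin (n + 2)) + 1, h⟩ < g 0) ↔
          g (Fin.succ 0) < g 0 := ⟨fun ⟨_, h⟩ => h, fun h => ⟨Nat.succ_lt_succ n.succ_pos, h⟩⟩
      have h1 : ∀ i : Fin (n + 1), (∃ h : (i.succ : ℕ) + 1 < n + 1 + 1,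
          g ⟨(i.succ : ℕ) + 1, h⟩ < g i.succ) ↔
          ∃ h : (i : ℕ) + 1 < n + 1, g (Fin.succ ⟨i + 1, h⟩) < g i.succ := fun i =>
        ⟨fun ⟨h, h'⟩ => ⟨Nat.lt_of_succ_lt_succ h, h'⟩, fun ⟨h, h'⟩ => ⟨Nat.succ_lt_succ h, h'⟩⟩
      have hcard := congrArg Finset.card (Finset.filter_congr (s := Finset.univ) fun i _ => h1 i)
      by_cases hg : g (Fin.succ 0) < g 0
      · rw [if_pos hg, if_pos (h0.2 hg), add_comm]
        exact congrArg (· + 1) hcard.symm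
      · rw [if_neg hg, if_neg fun h => hg (h0.1 h), zero_add]
        exact hcard.symm

theorem listRightToLeftMaxima_ofFn {n : ℕ} (g : Fin n → U) :
    listRightToLeftMaxima (List.ofFn g) =
      (Finset.univ.filter fun i : Fin n => ∀ j : Fin n, i < j → g j < g i).card := by
  induction n with
  | zero => simp [listRightToLeftMaxima]
  | succ n ih =>
    rw [List.ofFn_succ, listRightToLeftMaxima, ih, Fin.card_filter_univ_succ]
    have h0 : (∀ j : Fin (n + 1), 0 < j → g j < g 0) ↔
        ∀ b ∈ List.ofFn fun i : Fin n => g i.succ, b < g 0 := by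
      simp [Fin.forall_fin_succ, List.mem_ofFn]
    have h1 : ∀ i : Fin n, (∀ j : Fin (n + 1), i.succ < j → g j < g i.succ) ↔
        ∀ j : Fin n, i < j → g j.succ < g i.succ := by
      intro i
      simp [Fin.forall_fin_succ]
    simp only [h0, h1]
    split_ifs <;> omega

theorem runWeight_ofFn {n : ℕ} (acc : List U) (g : Fin n → U) :
    runWeight acc (List.ofFn g) = ∏ i : Fin n, displacementFactor
      ((((List.ofFn g).take i).reverse ++ acc).takeWhile fun b => decide (b < g i)).length := by
  induction n generalizing acc with
  | zero => simp [runWeight]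
  | succ n ih =>
    rw [List.ofFn_succ, runWeight, ih, Fin.prod_univ_succ]
    simp

theorem le_length_takeWhile_iff {α : Type*} {p : α → Bool} {l : List α} {k : ℕ} :
    k ≤ (l.takeWhile p).length ↔ k ≤ l.length ∧ ∀ j (h : j < l.length), j < k → p l[j] := by
  induction l generalizing k with
  | nil => simp
  | cons a l ih =>
    cases k with
    | zero => simp
    | succ k =>
      rw [List.takeWhile_cons]
      by_cases ha : p a
      · rw [if_pos ha, List.length_cons, Nat.succ_le_succ_iff, ih]
        refine and_congr Nat.succ_le_succ_iff.symm ⟨fun h j hj hk => ?_, fun h j hj hk => ?_⟩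
        · cases j with
          | zero => exact ha
          | succ j => exact h j (Nat.lt_of_succ_lt_succ hj) (Nat.lt_of_succ_lt_succ hk)
        · exact h (j + 1) (Nat.succ_lt_succ hj) (Nat.succ_lt_succ hk)
      · rw [if_neg ha]
        refine iff_of_false (by simp) fun h => ha (h.2 0 (by simp) (Nat.succ_pos k))

/-- The sum of rank weights over the starting points of runs of smaller entries that end directly
before position `s`. -/
theorem sum_rankWeight_run {n : ℕ} (g : Fin n → U) (s : Fin n) :
    ∑ p ∈ Finset.univ.filter (fun p : Fin n => p ≤ s ∧ ∀ t, p ≤ t → t < s → g t < g s),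
        rankWeight (s - p) =
      displacementFactor
        (((List.ofFn g).take s).reverse.takeWhile fun b => decide (b < g s)).length := by
  have hlen : ((List.ofFn g).take s).reverse.length = s := by simp
  -- Entry `j` of the reversed prefix sits at position `s - 1 - j`, so a run of length at least `k`
  -- occupies the positions from `s - k` to `s - 1`.
  have key : ∀ k, k ≤ (((List.ofFn g).take s).reverse.takeWhile
      fun b => decide (b < g s)).length ↔
      k ≤ (s : ℕ) ∧ ∀ t : Fin n, (s : ℕ) - k ≤ t → t < s → g t < g s := by
    intro k
    rw [le_length_takeWhile_iff]
    have hks : k ≤ ((List.ofFn g).take s).reverse.length ↔ k ≤ (s : ℕ) := by rw [hlen]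
    refine (and_congr_left' hks).trans (and_congr_right fun hk =>
      ⟨fun h t ht hts => ?_, fun h j hj hjk => ?_⟩)
    · have hts' : (t : ℕ) < s := hts
      have := h (s - 1 - t) (by omega) (by omega)
      have e : (s : ℕ) - 1 - (s - 1 - t) = t := by omega
      simpa [List.getElem_reverse, Nat.min_eq_left s.2.le, e] using this
    · have := h ⟨s - 1 - j, by omega⟩ (by simp only; omega) (by rw [Fin.lt_def]; simp only; omega)
      simpa [List.getElem_reverse, Nat.min_eq_left s.2.le] using this
  rw [displacementFactor_eq_sum]
  -- A starting point corresponds to its displacement `s - p`; `p = s` is allowed, so the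
  -- displacements run from `0` to the run length inclusive.
  refine Finset.sum_bij' (fun p _ => (s : ℕ) - p) (fun k _ => ⟨s - k, by omega⟩) ?_ ?_ ?_ ?_ ?_
  · intro p hp
    rw [Finset.mem_filter] at hp
    have hps : (p : ℕ) ≤ s := hp.2.1
    rw [Finset.mem_range, Nat.lt_succ_iff, key]
    refine ⟨Nat.sub_le _ _, fun t ht hts => hp.2.2 t ?_ hts⟩
    rw [Fin.le_def]
    omega
  · intro k hk
    rw [Finset.mem_range, Nat.lt_succ_iff, key] at hk
    rw [Finset.mem_filter]
    refine ⟨Finset.mem_univ _, ?_, fun t ht hts => hk.2 t ht hts⟩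
    rw [Fin.le_def]
    exact Nat.sub_le _ _
  · intro p hp
    rw [Finset.mem_filter] at hp
    have hps : (p : ℕ) ≤ s := hp.2.1
    ext
    simp only
    omega
  · intro k hk
    rw [Finset.mem_range, Nat.lt_succ_iff, key] at hk
    simp only
    omega
  · exact fun _ _ => rfl

theorem sum_perm_ofFn {R : Type*} [AddCommMonoid R] {n : ℕ} (φ : List (Fin n) → R) :
    ∑ c : Equiv.Perm (Fin n), φ (List.ofFn c) =
      ∑ l ∈ arrangements (Finset.univ : Finset (Fin n)), φ l := by
  refine Finset.sum_bij (fun c _ => List.ofFn c) (fun c _ => ?_) (fun c _ d _ h => ?_)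
    (fun l hl => ?_) fun _ _ => rfl
  · rw [mem_arrangements]
    exact ⟨List.nodup_ofFn.2 c.injective, fun a => iff_of_true
      ((List.mem_ofFn' c a).2 (c.surjective a)) (Finset.mem_univ a)⟩
  · exact DFunLike.coe_injective (List.ofFn_injective h)
  · have hlen := length_of_mem_arrangements hl
    rw [Finset.card_univ, Fintype.card_fin] at hlen
    rw [mem_arrangements] at hl
    have hinj : Function.Injective fun i : Fin n => l.get (i.cast hlen.symm) :=
      (List.nodup_iff_injective_get.1 hl.1).comp (Fin.cast_injective hlen.symm)
    refine ⟨Equiv.ofBijective _ (Finite.injective_iff_bijective.1 hinj), Finset.mem_univ _, ?_⟩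
    exact List.ext_getElem (by simp [hlen]) (by simp)

end WordsOfFunctions

/-! ### Parking functions with a given outcome -/

section Parking

variable {n : ℕ}

/-- The preferences with which car `i` parks in the space prescribed by `b`, if the earlier cars
do so. -/
def preferenceRange (b : Equiv.Perm (Fin n)) (i : Fin n) : Finset (Fin n) :=
  Finset.univ.filter fun p => p ≤ b i ∧ ∀ s, p ≤ s → s < b i → b⁻¹ s < i

/-- By induction the earlier cars occupy the spaces given by `b`: then `b i` is free, and each space
from `π i` up to it is taken by an earlier car. -/
theorem parkingSpot_eq_of_mem {π : Fin n → Fin n} {b : Equiv.Perm (Fin n)}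
    (h : ∀ i, π i ∈ preferenceRange b i) (i : Fin n) : parkingSpot π i = b i := by
  induction i using WellFoundedLT.induction with
  | _ i ih =>
    have hi := h i
    rw [preferenceRange, Finset.mem_filter] at hi
    rw [parkingSpot]
    refine le_antisymm (Finset.min_le (Finset.mem_filter.2 ⟨Finset.mem_univ _, hi.2.1, ?_⟩))
      (Finset.le_min fun s hs => WithTop.coe_le_coe.2 (not_lt.1 fun hlt => ?_))
    · rintro ⟨j, hj⟩
      rw [ih j hj]
      exact fun e => hj.ne (b.injective (WithTop.coe_injective e))
    · rw [Finset.mem_filter] at hs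
      have hlt' := hi.2.2 s hs.2.1 hlt
      refine hs.2.2 ⟨_, hlt'⟩ ?_
      rw [ih _ hlt', show b (b⁻¹ s) = s from b.apply_symm_apply s]

theorem ParkingFunction.coe_outcome (π : ParkingFunction n) (i : Fin n) :
    (π.outcome i : WithTop (Fin n)) = parkingSpot π.1 i :=
  WithTop.coe_untop _ (π.2 i)

theorem ParkingFunction.mem_preferenceRange (π : ParkingFunction n) (i : Fin n) :
    π.1 i ∈ preferenceRange π.outcome i := by
  have h := (π.coe_outcome i).symm
  rw [parkingSpot] at h
  have hmem := Finset.mem_of_min h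
  rw [Finset.mem_filter] at hmem
  rw [preferenceRange, Finset.mem_filter]
  refine ⟨Finset.mem_univ _, hmem.2.1, fun s hs hlt => ?_⟩
  by_contra hle
  refine (Finset.notMem_of_lt_min hlt h) (Finset.mem_filter.2 ⟨Finset.mem_univ _, hs, ?_⟩)
  rintro ⟨j, hj⟩ e
  rw [← π.coe_outcome j] at e
  refine hle ?_
  rw [← WithTop.coe_injective e]
  exact (π.outcome.symm_apply_apply j).trans_lt hj

/-- The parking functions with outcome `b` form the product of the sets `preferenceRange b i`: each
car's preference can be chosen independently. -/
theorem sum_parkingFunction {R : Type*} [AddCommMonoid R]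
    (φ : Equiv.Perm (Fin n) → (Fin n → Fin n) → R) :
    ∑ π : ParkingFunction n, φ π.outcome π.1 =
      ∑ b : Equiv.Perm (Fin n), ∑ π ∈ Fintype.piFinset (preferenceRange b), φ b π := by
  rw [Finset.sum_sigma']
  refine Finset.sum_bij (fun π _ => ⟨π.outcome, π.1⟩) (fun π _ => ?_) (fun π _ σ _ h => ?_)
    (fun q hq => ?_) fun _ _ => rfl
  · exact Finset.mem_sigma.2 ⟨Finset.mem_univ _, Fintype.mem_piFinset.2 π.mem_preferenceRange⟩
  · rw [Sigma.mk.injEq] at h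
    exact Subtype.ext (eq_of_heq h.2)
  · obtain ⟨b, π⟩ := q
    have h := parkingSpot_eq_of_mem (Fintype.mem_piFinset.1 (Finset.mem_sigma.1 hq).2)
    dsimp only at h
    have hπ : IsParkingFunction π := fun i => by
      rw [h i]
      exact WithTop.coe_ne_top
    refine ⟨⟨π, hπ⟩, Finset.mem_univ _, ?_⟩
    have : ParkingFunction.outcome ⟨π, hπ⟩ = b := Equiv.ext fun i =>
      WithTop.coe_injective ((ParkingFunction.coe_outcome ⟨π, hπ⟩ i).trans (h i))
    rw [this]

theorem ParkingFunction.prod_rankWeight (π : ParkingFunction n) :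
    ∏ i, rankWeight (π.outcome i - π.1 i) = X 0 ^ π.unl * X 1 ^ π.dis := by
  rw [_root_.prod_rankWeight, unl, dis, Finset.card_filter]
  congr 2
  refine Finset.sum_congr rfl fun i _ => ?_
  have h := π.mem_preferenceRange i
  rw [preferenceRange, Finset.mem_filter, Fin.le_def] at h
  rw [← ite_not]
  exact if_congr (by rw [ne_eq, Fin.ext_iff]; omega) rfl rfl

/-- For the outcome `c⁻¹` and the car `c s`, which parks in `s`, the requirement that the spaces
passed be taken by earlier cars reads `c t < c s`: the preferences are the starting points of runs
of smaller letters. -/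
theorem sum_preferenceRange (c : Equiv.Perm (Fin n)) (s : Fin n) :
    ∑ p ∈ preferenceRange c⁻¹ (c s), rankWeight (c⁻¹ (c s) - p) = displacementFactor
        (((List.ofFn c).take s).reverse.takeWhile fun b => decide (b < c s)).length := by
  rw [← sum_rankWeight_run, preferenceRange, inv_inv,
    show c⁻¹ (c s) = s from c.symm_apply_apply s]

theorem parkingPoly_eq_listSum (n : ℕ) :
    parkingPoly n = listSum (Finset.univ : Finset (Fin n)) := by
  have h1 : parkingPoly n = ∑ b : Equiv.Perm (Fin n),
      ∑ π ∈ Fintype.piFinset (preferenceRange b), (∏ i, rankWeight (b i - π i)) *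
        X 2 ^ permDescents b⁻¹ * X 3 ^ permRightToLeftMaxima b⁻¹ := by
    rw [← sum_parkingFunction fun b π => (∏ i, rankWeight (b i - π i)) *
        X 2 ^ permDescents b⁻¹ * X 3 ^ permRightToLeftMaxima b⁻¹, parkingPoly]
    refine Finset.sum_congr rfl fun π _ => ?_
    rw [π.prod_rankWeight, ParkingFunction.des, ParkingFunction.rlm]
  rw [h1, listSum, ← sum_perm_ofFn, ← Equiv.sum_comp (Equiv.inv (Equiv.Perm (Fin n)))]
  refine Finset.sum_congr rfl fun c _ => ?_
  -- The sum over a product of preference ranges becomes a product of sums over cars, which is then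
  -- reindexed by the spaces they occupy.
  rw [Equiv.inv_apply, inv_inv, ← Finset.sum_mul, ← Finset.sum_mul,
    ← Finset.prod_univ_sum (preferenceRange c⁻¹) fun i p => rankWeight (c⁻¹ i - p),
    ← Equiv.prod_comp c, listWeight, runWeight_ofFn, listDescents_ofFn,
    listRightToLeftMaxima_ofFn]
  simp only [sum_preferenceRange, List.append_nil, permDescents, permRightToLeftMaxima]

theorem parkingPoly_eq_recPoly (n : ℕ) : parkingPoly n = recPoly n := by
  rw [parkingPoly_eq_listSum, listSum_eq_recPoly, Finset.card_univ, Fintype.card_fin]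

end Parking

theorem mainTheorem2 :
    SatisfiesRecurrence parkingPoly ∧ SatisfiesRecurrence treePoly ∧
      parkingPoly 0 = 1 ∧ treePoly 0 = 1 ∧ ∀ n : ℕ, parkingPoly n = treePoly n := by
  have hP : parkingPoly = recPoly := funext parkingPoly_eq_recPoly
  have hT : treePoly = recPoly := funext treePoly_eq_recPoly
  rw [hP, hT]
  exact ⟨satisfiesRecurrence_recPoly, satisfiesRecurrence_recPoly, recPoly_zero, recPoly_zero,
    fun _ => rfl⟩
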